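/- Let $G$ be a discrete group with unit $e$. For a $C^*$-algebra $\mathcal B$ let $\ell^1(G;\mathcal B)\ (\cong \ell^1(G)\widehat\otimes\mathcal B)$ be the Banach $^*$-algebra of absolutely summable functions $f:G\to\mathcal B$ with product $(f\star g)(x)=\sum_{y\in G}f(y)g(y^{-1}x)$ and involution $f^\star(x)=f(x^{-1})^*$. A Banach $^*$-algebra is called symmetric if the spectrum of $b^*b$ is contained in $[0,\infty)$ for each of its elements $b$, and $G$ is called rigidly symmetric if $\ell^1(G;\mathcal B)$ is symmetric for every $C^*$-algebra $\mathcal B$. Let $\mathcal A$ be a unital $C^*$-algebra with a twisted action $(\alpha,\omega)$ of $G$: each $\alpha_x$ $(x\in G)$ is a $^*$-automorphism of $\mathcal A$, each $\omega(x,y)$ $(x,y\in G)$ is a unitary element of $\mathcal A$, and for all $x,y,z\in G$ and $a\in\mathcal A$ $$\alpha_x(\alpha_y(a))=\omega(x,y)\,\alpha_{xy}(a)\,\omega(x,y)^*,\qquad \omega(x,y)\,\omega(xy,z)=\alpha_x[\omega(y,z)]\,\omega(x,yz),\qquad \omega(x,e)=1=\omega(e,x).$$ Let $\ell^1_{\alpha,\omega}(G;\mathcal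 A)$ be the space $\ell^1(G;\mathcal A)$ regarded as a Banach $^*$-algebra with $$(f\diamond g)(x)=\sum_{y\in G}f(y)\,\alpha_y[g(y^{-1}x)]\,\omega(y,y^{-1}x),\qquad f^{\diamond}(x)=\omega(x,x^{-1})^*\,\alpha_x[f(x^{-1})]^*,$$ let $\mathfrak C=\mathcal A\rtimes_\alpha^\omega G$ be its enveloping $C^*$-algebra (the Hausdorff completion in the largest $C^*$-seminorm), and let $\mathfrak B\subseteq\mathfrak C$ be the canonical image of $\ell^1_{\alpha,\omega}(G;\mathcal A)$. Let $\mathcal J$ be a closed self-adjoint two-sided ideal of $\mathcal A$ with $\alpha_x(\mathcal J)\subseteq\mathcal J$ for all $x\in G$, and let $\mathfrak J=\mathcal J\rtimes_\alpha^\omega G$, identified with the closed two-sided ideal of $\mathfrak C$ that is the closure of the image of $\ell^1(G;\mathcal J)$. Theorem. If $G$ is rigidly symmetric, then $\mathfrak B$ is inverse closed in $\mathfrak C$ modulo $\mathfrak J$: whenever $f\in\mathfrak B$ and $g\in\mathfrak C$ satisfy $fg-1\in\mathfrak J$ and $gf-1\in\mathfrak J$, there is $g'\in\mathfrak B$ with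 $g'-g\in\mathfrak J$. Equivalently, the image of $\mathfrak B$ in $\mathfrak C/\mathfrak J$ is inverse closed: if an element of this image is invertible in $\mathfrak C/\mathfrak J$, then its inverse belongs to the image. -/

import Mathlib

universe u v w

noncomputable section

namespace TwistedCrossed

/-! ### Summable functions on a discrete group with a graded product

The algebras of `ℓ¹`-functions used below differ only in how a value at `x` is multiplied with a
value at `y`, and in how values are conjugated.  `FibreOps` records such rules; the two
instances used are `plainOps` and `TwistedSystem.ops`. -/

/-- Rules for multiplying a value at `x` with a value at `y` (giving a value at `x * y`), and
for conjugating a value at `x` (giving a value at `x⁻¹`), with the laws that make the convolution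
of `ℓ¹`-functions a Banach `*`-algebra. -/
structure FibreOps (G : Type u) (B : Type v) [Group G] [NormedAddCommGroup B]
    [NormedSpace ℂ B] where
  mul : G → G → B →ₗ[ℂ] B →ₗ[ℂ] B
  inv : G → B →ₗ⋆[ℂ] B
  norm_mul_le : ∀ x y a b, ‖mul x y a b‖ ≤ ‖a‖ * ‖b‖
  norm_inv : ∀ x a, ‖inv x a‖ = ‖a‖
  mul_assoc : ∀ x y z a b c, mul (x * y) z (mul x y a b) c = mul x (y * z) a (mul y z b c)
  inv_inv : ∀ x a, inv x⁻¹ (inv x a) = a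
  inv_mul : ∀ x y a b, inv (x * y) (mul x y a b) = mul y⁻¹ x⁻¹ (inv y b) (inv x a)

/-- The space `ℓ¹(G; B)`, to be equipped with the convolution product and the involution
determined by `F`. -/
def L1 {G : Type u} {B : Type v} [Group G] [NormedAddCommGroup B] [NormedSpace ℂ B]
    (_F : FibreOps G B) : Type (max u v) :=
  lp (fun _ : G => B) 1

namespace L1

variable {G : Type u} {B : Type v} [Group G] [NormedAddCommGroup B] [NormedSpace ℂ B]
variable {F : FibreOps G B}

instance : NormedAddCommGroup (L1 F) := inferInstanceAs (NormedAddCommGroup (lp (fun _ : G => B) 1))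

instance : NormedSpace ℂ (L1 F) := inferInstanceAs (NormedSpace ℂ (lp (fun _ : G => B) 1))

instance [CompleteSpace B] : CompleteSpace (L1 F) :=
  inferInstanceAs (CompleteSpace (lp (fun _ : G => B) 1))

/-- The function underlying an element of `ℓ¹(G; B)`. -/
def toFun (f : L1 F) : G → B := f.1

instance : CoeFun (L1 F) fun _ => G → B := ⟨toFun⟩

theorem ext {f g : L1 F} (h : ∀ x, f x = g x) : f = g := lp.ext (funext h)

theorem add_apply (f g : L1 F) (x : G) : (f + g) x = f x + g x := rfl

theorem smul_apply (c : ℂ) (f : L1 F) (x : G) : (c • f) x = c • f x := rfl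

theorem zero_apply (x : G) : (0 : L1 F) x = 0 := rfl

theorem summable_norm (f : L1 F) : Summable fun x => ‖f x‖ := by
  simpa using! (lp.memℓp (E := fun _ : G => B) f).summable (by simp)

theorem norm_eq (f : L1 F) : ‖f‖ = ∑' x, ‖f x‖ := by
  have := lp.norm_eq_tsum_rpow (E := fun _ : G => B) (p := 1) (by simp) f
  simpa using! this

/-- The element of `ℓ¹(G; B)` given by an absolutely summable function. -/
def mk (f : G → B) (hf : Summable fun x => ‖f x‖) : L1 F :=
  ⟨f, memℓp_gen (by simpa using hf)⟩

theorem mk_apply (f : G → B) (hf : Summable fun x => ‖f x‖) (x : G) :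
    (mk f hf : L1 F) x = f x := rfl

theorem norm_apply_le (f : L1 F) (x : G) : ‖f x‖ ≤ ‖f‖ :=
  lp.norm_apply_le_norm (E := fun _ : G => B) (by simp) f x

/-- The fibre product as a continuous bilinear map. -/
def mulL (F : FibreOps G B) (x y : G) : B →L[ℂ] B →L[ℂ] B :=
  (F.mul x y).mkContinuous₂ 1 fun a b => by simpa using F.norm_mul_le x y a b

theorem mulL_apply (F : FibreOps G B) (x y : G) (a b : B) : mulL F x y a b = F.mul x y a b := rfl

/-- The fibre conjugation as a continuous conjugate-linear map. -/
def invL (F : FibreOps G B) (x : G) : B →L⋆[ℂ] B :=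
  (F.inv x).mkContinuous 1 fun a => by simpa using (F.norm_inv x a).le

theorem invL_apply (F : FibreOps G B) (x : G) (a : B) : invL F x a = F.inv x a := rfl

/-- The change of variables `(x, y) ↦ (y, y⁻¹ x)`. -/
def shear (G : Type u) [Group G] : G × G ≃ G × G where
  toFun p := (p.2, p.2⁻¹ * p.1)
  invFun p := (p.1 * p.2, p.1)
  left_inv p := by simp
  right_inv p := by simp

theorem summable_shear (f g : L1 F) :
    Summable fun p : G × G => ‖f p.2‖ * ‖g (p.2⁻¹ * p.1)‖ :=
  (shear G).summable_iff.mpr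
    (f.summable_norm.mul_of_nonneg g.summable_norm (fun _ => norm_nonneg _) fun _ => norm_nonneg _)

theorem summable_conv_norm (f g : L1 F) (x : G) :
    Summable fun y => ‖f y‖ * ‖g (y⁻¹ * x)‖ :=
  (summable_shear f g).prod_factor x

theorem summable_term_norm (f g : L1 F) (x : G) :
    Summable fun y => ‖F.mul y (y⁻¹ * x) (f y) (g (y⁻¹ * x))‖ :=
  Summable.of_nonneg_of_le (fun _ => norm_nonneg _) (fun _ => F.norm_mul_le _ _ _ _)
    (summable_conv_norm f g x)

theorem norm_conv_le (f g : L1 F) (x : G) :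
    ‖∑' y, F.mul y (y⁻¹ * x) (f y) (g (y⁻¹ * x))‖ ≤ ∑' y, ‖f y‖ * ‖g (y⁻¹ * x)‖ :=
  (norm_tsum_le_tsum_norm (summable_term_norm f g x)).trans
    ((summable_term_norm f g x).tsum_le_tsum (fun _ => F.norm_mul_le _ _ _ _)
      (summable_conv_norm f g x))

theorem summable_conv (f g : L1 F) :
    Summable fun x => ‖∑' y, F.mul y (y⁻¹ * x) (f y) (g (y⁻¹ * x))‖ :=
  Summable.of_nonneg_of_le (fun _ => norm_nonneg _) (norm_conv_le f g) (summable_shear f g).prod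

instance : Mul (L1 F) := ⟨fun f g => mk _ (summable_conv f g)⟩

theorem mul_apply (f g : L1 F) (x : G) :
    (f * g) x = ∑' y, F.mul y (y⁻¹ * x) (f y) (g (y⁻¹ * x)) := rfl

theorem norm_mul_le' (f g : L1 F) : ‖f * g‖ ≤ ‖f‖ * ‖g‖ := by
  rw [norm_eq, norm_eq f, norm_eq g, tsum_mul_tsum_of_summable_norm
    (by simpa using f.summable_norm) (by simpa using g.summable_norm), ← (shear G).tsum_eq]
  refine ((summable_conv f g).tsum_le_tsum (norm_conv_le f g) (summable_shear f g).prod).trans ?_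
  exact ((summable_shear f g).tsum_prod' fun x => summable_conv_norm f g x).ge

theorem summable_inv (f : L1 F) : Summable fun x => ‖F.inv x⁻¹ (f x⁻¹)‖ := by
  simp only [F.norm_inv]
  exact (Equiv.inv G).summable_iff.mpr f.summable_norm

instance : Star (L1 F) := ⟨fun f => mk _ (summable_inv f)⟩

theorem star_apply (f : L1 F) (x : G) : (star f) x = F.inv x⁻¹ (f x⁻¹) := rfl

variable [CompleteSpace B]

theorem summable_term (f g : L1 F) (x : G) :
    Summable fun y => F.mul y (y⁻¹ * x) (f y) (g (y⁻¹ * x)) :=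
  (summable_term_norm f g x).of_norm

theorem mul_assoc' (f g h : L1 F) : f * g * h = f * (g * h) := by
  refine ext fun x => ?_
  let T : G → G → B := fun u y =>
    F.mul u (u⁻¹ * x) (F.mul y (y⁻¹ * u) (f y) (g (y⁻¹ * u))) (h (u⁻¹ * x))
  have hT : Summable (Function.uncurry T) := by
    refine Summable.of_norm_bounded ((summable_shear f g).mul_right ‖h‖) ?_
    rintro ⟨u, y⟩
    refine (F.norm_mul_le _ _ _ _).trans ?_
    gcongr
    · exact F.norm_mul_le _ _ _ _
    · exact norm_apply_le _ _
  have hL : (f * g * h) x = ∑' u, ∑' y, T u y := by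
    rw [mul_apply]
    refine tsum_congr fun u => ?_
    rw [mul_apply, ← mulL_apply, ContinuousLinearMap.map_tsum _ (summable_term f g u)]
    exact ((ContinuousLinearMap.apply ℂ B (h (u⁻¹ * x))).map_tsum
      ((mulL F u (u⁻¹ * x)).summable (summable_term f g u)))
  have hR : (f * (g * h)) x = ∑' y, ∑' u, T u y := by
    rw [mul_apply]
    refine tsum_congr fun y => ?_
    rw [mul_apply, ← mulL_apply, ContinuousLinearMap.map_tsum _ (summable_term g h _),
      ← (Equiv.mulLeft y⁻¹).tsum_eq]
    refine tsum_congr fun u => ?_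
    have e1 : (y⁻¹ * u)⁻¹ * (y⁻¹ * x) = u⁻¹ * x := by group
    have e2 : y⁻¹ * u * (u⁻¹ * x) = y⁻¹ * x := by group
    have e3 : y * (y⁻¹ * u) = u := by group
    have := F.mul_assoc y (y⁻¹ * u) (u⁻¹ * x) (f y) (g (y⁻¹ * u)) (h (u⁻¹ * x))
    rw [e2, e3] at this
    simp only [Equiv.coe_mulLeft, e1, mulL_apply, T]
    exact this.symm
  rw [hL, hR]
  exact hT.tsum_comm.symm

instance : NonUnitalNormedRing (L1 F) where
  __ : NormedAddCommGroup (L1 F) := inferInstance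
  left_distrib f g h := ext fun x => by
    simp only [mul_apply, add_apply, map_add]
    exact (summable_term f g x).tsum_add (summable_term f h x)
  right_distrib f g h := ext fun x => by
    simp only [mul_apply, add_apply, map_add, LinearMap.add_apply]
    exact (summable_term f h x).tsum_add (summable_term g h x)
  zero_mul f := ext fun x => by simp [mul_apply, zero_apply]
  mul_zero f := ext fun x => by simp [mul_apply, zero_apply]
  mul_assoc := mul_assoc'
  norm_mul_le := norm_mul_le'

instance : IsScalarTower ℂ (L1 F) (L1 F) where
  smul_assoc c f g := ext fun x => by
    simp only [smul_eq_mul, mul_apply, smul_apply, map_smul, LinearMap.smul_apply]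
    exact (summable_term f g x).tsum_const_smul c

instance : SMulCommClass ℂ (L1 F) (L1 F) where
  smul_comm c f g := ext fun x => by
    simp only [smul_eq_mul, mul_apply, smul_apply, map_smul]
    exact ((summable_term f g x).tsum_const_smul c).symm

instance : StarRing (L1 F) where
  star_involutive f := ext fun x => by
    rw [star_apply, star_apply, inv_inv]
    exact F.inv_inv x (f x)
  star_mul f g := ext fun x => by
    rw [star_apply, mul_apply, mul_apply, ← invL_apply,
      ContinuousLinearMap.map_tsum _ (summable_term f g _),
      ← (Equiv.mulLeft x).tsum_eq fun z => F.mul z (z⁻¹ * x) _ _]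
    refine tsum_congr fun y => ?_
    have := F.inv_mul y (y⁻¹ * x⁻¹) (f y) (g (y⁻¹ * x⁻¹))
    have e1 : y * (y⁻¹ * x⁻¹) = x⁻¹ := by group
    have e2 : (y⁻¹ * x⁻¹)⁻¹ = x * y := by group
    have e3 : (x * y)⁻¹ * x = y⁻¹ := by group
    have e4 : (x * y)⁻¹ = y⁻¹ * x⁻¹ := by group
    rw [e1, e2] at this
    simp only [Equiv.coe_mulLeft, star_apply, e3, invL_apply, this, inv_inv]
    rw [e4]
  star_add f g := ext fun x => by simp [star_apply, add_apply]

instance : StarModule ℂ (L1 F) where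
  star_smul c f := ext fun x => by simp [star_apply, smul_apply]

instance : NormedStarGroup (L1 F) where
  norm_star_le f := by
    rw [norm_eq, norm_eq f, ← (Equiv.inv G).tsum_eq fun x => ‖f x‖]
    simp only [star_apply, F.norm_inv]
    exact le_rfl

end L1

/-! ### Rigid symmetry -/

/-- The untwisted rules `(a, b) ↦ a b` and `a ↦ a*` for a `C*`-algebra of values. -/
def plainOps (G : Type u) (B : Type v) [Group G] [NonUnitalCStarAlgebra B] : FibreOps G B where
  mul _ _ := LinearMap.mul ℂ B
  inv _ := (starLinearEquiv ℂ : B ≃ₗ⋆[ℂ] B).toLinearMap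
  norm_mul_le _ _ a b := by simpa using norm_mul_le a b
  norm_inv _ a := by simp
  mul_assoc _ _ _ a b c := by simp [mul_assoc]
  inv_inv _ a := by simp
  inv_mul _ _ a b := by simp

theorem plain_mul_apply {G : Type u} {B : Type v} [Group G] [NonUnitalCStarAlgebra B]
    (f g : L1 (plainOps G B)) (x : G) : (f * g) x = ∑' y, f y * g (y⁻¹ * x) := rfl

theorem plain_star_apply {G : Type u} {B : Type v} [Group G] [NonUnitalCStarAlgebra B]
    (f : L1 (plainOps G B)) (x : G) : (star f) x = star (f x⁻¹) := rfl

/-- A (not necessarily unital) complex `*`-algebra is symmetric if the spectrum of `b* b` is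
contained in `[0, ∞)` for all `b`.  The quasispectrum is the spectrum in the unitization; for a
unital algebra it is the spectrum with `0` adjoined. -/
def IsSymmetricAlgebra (R : Type w) [NonUnitalRing R] [Module ℂ R] [Star R] : Prop :=
  ∀ b : R, ∀ z ∈ quasispectrum ℂ (star b * b), 0 ≤ z.re ∧ z.im = 0

/-- The discrete group `G` is rigidly symmetric: the convolution algebra `ℓ¹(G; B)` (that is, the
projective tensor product of `ℓ¹(G)` and `B`) is symmetric for every `C*`-algebra `B`. -/
def IsRigidlySymmetric (G : Type u) [Group G] : Prop :=
  ∀ (B : Type w) [NonUnitalCStarAlgebra B], IsSymmetricAlgebra (L1 (plainOps G B))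

/-! ### Twisted `C*`-dynamical systems and their `ℓ¹`-algebras -/

/-- A twisted action `(α, ω)` of the discrete group `G` on the unital `C*`-algebra `A`. -/
structure TwistedSystem (G : Type u) (A : Type v) [Group G] [CStarAlgebra A] where
  α : G → (A ≃⋆ₐ[ℂ] A)
  ω : G → G → unitary A
  α_comp : ∀ x y a, α x (α y a) = (ω x y : A) * α (x * y) a * star (ω x y : A)
  cocycle : ∀ x y z, (ω x y : A) * (ω (x * y) z : A) = α x (ω y z : A) * (ω x (y * z) : A)
  ω_one_right : ∀ x, ω x 1 = 1
  ω_one_left : ∀ x, ω 1 x = 1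

namespace TwistedSystem

variable {G : Type u} {A : Type v} [Group G] [CStarAlgebra A] (S : TwistedSystem G A)

theorem α_one (a : A) : S.α 1 a = a := by
  apply (S.α 1).injective
  simpa [S.ω_one_left] using S.α_comp 1 1 a

theorem norm_α (x : G) (a : A) : ‖S.α x a‖ = ‖a‖ := StarAlgEquiv.norm_map (S.α x) a

theorem star_ω_mul (x y : G) : star (S.ω x y : A) * (S.ω x y : A) = 1 :=
  Unitary.coe_star_mul_self _

theorem ω_mul_star (x y : G) : (S.ω x y : A) * star (S.ω x y : A) = 1 :=
  Unitary.coe_mul_star_self _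

/-- The twisted rules `(a, b) ↦ a α_x(b) ω(x, y)` and `a ↦ ω(x⁻¹, x)* α_{x⁻¹}(a)*`. -/
def ops : FibreOps G A where
  mul x y := LinearMap.mk₂ ℂ (fun a b => a * S.α x b * (S.ω x y : A))
    (by intros; simp [add_mul]) (by intros; simp)
    (by intros; simp [add_mul, mul_add]) (by intros; simp)
  inv x :=
    { toFun := fun a => star (S.ω x⁻¹ x : A) * star (S.α x⁻¹ a)
      map_add' := by intros; simp [mul_add]
      map_smul' := by intros; simp }
  norm_mul_le x y a b := by
    simp only [LinearMap.mk₂_apply, CStarRing.norm_mul_coe_unitary]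
    exact (norm_mul_le _ _).trans_eq (by rw [S.norm_α])
  norm_inv x a := by
    have : star (S.ω x⁻¹ x : A) = ((star (S.ω x⁻¹ x) : unitary A) : A) := rfl
    simp only [LinearMap.coe_mk, AddHom.coe_mk, this, CStarRing.norm_coe_unitary_mul, norm_star,
      S.norm_α]
  mul_assoc x y z a b c := by
    simp only [LinearMap.mk₂_apply, map_mul, S.α_comp]
    have h := S.cocycle x y z
    have h2 := S.star_ω_mul x y
    calc a * S.α x b * (S.ω x y : A) * S.α (x * y) c * (S.ω (x * y) z : A)
        = a * S.α x b * (S.ω x y : A) * S.α (x * y) c *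
          (star (S.ω x y : A) * (S.ω x y : A)) * (S.ω (x * y) z : A) := by rw [h2, mul_one]
      _ = a * S.α x b * (S.ω x y : A) * S.α (x * y) c * star (S.ω x y : A) *
          ((S.ω x y : A) * (S.ω (x * y) z : A)) := by simp only [mul_assoc]
      _ = _ := by rw [h]; simp only [mul_assoc]
  inv_inv x a := by
    simp only [LinearMap.coe_mk, AddHom.coe_mk, map_mul, map_star, star_mul, star_star, inv_inv,
      S.α_comp]
    have h := S.cocycle x x⁻¹ x
    simp only [mul_inv_cancel, inv_mul_cancel, S.ω_one_left, S.ω_one_right, OneMemClass.coe_one,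
      mul_one] at h
    rw [← h, mul_inv_cancel, S.α_one]
    simp only [mul_assoc, S.star_ω_mul, mul_one]
    rw [← mul_assoc, S.star_ω_mul, one_mul]
  inv_mul x y a b := by
    simp only [LinearMap.coe_mk, AddHom.coe_mk, LinearMap.mk₂_apply, map_mul, map_star, star_mul,
      mul_inv_rev, S.α_comp]
    have h1 := S.cocycle (y⁻¹ * x⁻¹) x y
    have h2 := S.cocycle y⁻¹ x⁻¹ x
    have e1 : y⁻¹ * x⁻¹ * x = y⁻¹ := by group
    have e2 : (y⁻¹ * x⁻¹) * (x * y) = 1 := by group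
    simp only [inv_mul_cancel, e1, S.ω_one_right, OneMemClass.coe_one,
      mul_one] at h1 h2
    have h1s := congrArg star h1
    simp only [star_mul] at h1s
    rw [← h2]
    simp only [star_mul, star_star, mul_assoc]
    rw [← mul_assoc (star (S.ω (y⁻¹ * x⁻¹) (x * y) : A)), ← h1s, inv_mul_cancel, mul_one]
    simp only [mul_assoc]
    rw [← mul_assoc (star (S.ω (y⁻¹ * x⁻¹) x : A)) (S.ω (y⁻¹ * x⁻¹) x : A), S.star_ω_mul, one_mul,
      ← mul_assoc (star (S.ω y⁻¹ x⁻¹ : A)) (S.ω y⁻¹ x⁻¹ : A), S.star_ω_mul, one_mul, mul_one]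

theorem mul_apply (f g : L1 S.ops) (x : G) :
    (f * g) x = ∑' y, f y * S.α y (g (y⁻¹ * x)) * (S.ω y (y⁻¹ * x) : A) := rfl

theorem star_apply (f : L1 S.ops) (x : G) :
    (star f) x = star (S.ω x x⁻¹ : A) * star (S.α x (f x⁻¹)) := by
  have : (star f) x = star (S.ω x⁻¹⁻¹ x⁻¹ : A) * star (S.α x⁻¹⁻¹ (f x⁻¹)) := rfl
  rw [this, inv_inv]

open Classical in
/-- The unit of the twisted `ℓ¹`-algebra: the function equal to `1` at the neutral element and
to `0` elsewhere. -/
instance : One (L1 S.ops) :=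
  ⟨L1.mk (fun x => if x = 1 then 1 else 0) (summable_of_ne_finset_zero (s := {1}) (by
    intro x hx; simp at hx; simp [hx]))⟩

open Classical in
theorem one_apply (x : G) : (1 : L1 S.ops) x = if x = 1 then 1 else 0 := rfl

instance : NormedRing (L1 S.ops) where
  __ : NonUnitalNormedRing (L1 S.ops) := inferInstance
  one_mul f := L1.ext fun x => by
    rw [S.mul_apply, tsum_eq_single 1]
    · rw [S.one_apply, if_pos rfl, inv_one, one_mul, S.α_one, S.ω_one_left, one_mul]
      exact mul_one _
    · intro y hy; simp [S.one_apply, hy]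
  mul_one f := L1.ext fun x => by
    rw [S.mul_apply, tsum_eq_single x]
    · simp [S.one_apply, S.ω_one_right]
    · intro y hy
      have : y⁻¹ * x ≠ 1 := fun h => hy (inv_mul_eq_one.mp h)
      simp [S.one_apply, this]

instance : NormedAlgebra ℂ (L1 S.ops) where
  __ := Algebra.ofModule (R := ℂ) (A := L1 S.ops) smul_mul_assoc mul_smul_comm
  norm_smul_le := norm_smul_le

end TwistedSystem

/-! ### The enveloping `C*`-algebra -/

section Enveloping

variable (B : Type w) [NormedRing B] [NormedAlgebra ℂ B] [StarRing B] [StarModule ℂ B]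

variable {B} in
/-- A `C*`-seminorm on a normed `*`-algebra.  On a Banach `*`-algebra with
isometric involution contractivity is automatic;
these seminorms are those of the form `b ↦ ‖π b‖` with `π` a `*`-homomorphism into a
`C*`-algebra (equivalently, a `*`-representation on a Hilbert space). -/
structure IsCStarSeminorm (p : Seminorm ℂ B) : Prop where
  mul_le : ∀ a b, p (a * b) ≤ p a * p b
  star_mul_self : ∀ a, p (star a * a) = p a ^ 2
  le_norm : ∀ a, p a ≤ ‖a‖

instance : Nonempty {p : Seminorm ℂ B // IsCStarSeminorm p} :=
  ⟨0, ⟨by simp, by simp, by simp⟩⟩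

variable {B} in
theorem bddAbove_cstarSeminorm (b : B) :
    BddAbove (Set.range fun p : {p : Seminorm ℂ B // IsCStarSeminorm p} => p.1 b) :=
  ⟨‖b‖, by rintro _ ⟨p, rfl⟩; exact p.2.le_norm b⟩

variable {B} in
theorem le_universal (p : {p : Seminorm ℂ B // IsCStarSeminorm p}) (b : B) :
    p.1 b ≤ ⨆ q : {p : Seminorm ℂ B // IsCStarSeminorm p}, q.1 b :=
  le_ciSup (bddAbove_cstarSeminorm b) p

/-- The universal `C*`-seminorm: the supremum of all `C*`-seminorms. -/
def universalSeminorm : Seminorm ℂ B :=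
  Seminorm.of (fun b => ⨆ p : {p : Seminorm ℂ B // IsCStarSeminorm p}, p.1 b)
    (fun a b => ciSup_le fun p =>
      (map_add_le_add p.1 a b).trans (add_le_add (le_universal p a) (le_universal p b)))
    (fun c b => by
      simp only [map_smul_eq_mul]
      exact (Real.mul_iSup_of_nonneg (norm_nonneg c) _).symm)

theorem universalSeminorm_apply (b : B) :
    universalSeminorm B b = ⨆ p : {p : Seminorm ℂ B // IsCStarSeminorm p}, p.1 b := rfl

theorem isCStarSeminorm_universal : IsCStarSeminorm (universalSeminorm B) where
  mul_le a b := ciSup_le fun p => (p.2.mul_le a b).trans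
    (mul_le_mul (le_universal p a) (le_universal p b) (apply_nonneg _ _)
      (apply_nonneg (universalSeminorm B) a))
  star_mul_self a := by
    apply le_antisymm
    · refine ciSup_le fun p => ?_
      rw [p.2.star_mul_self]
      exact pow_le_pow_left₀ (apply_nonneg _ _) (le_universal p a) 2
    · have h0 : 0 ≤ universalSeminorm B (star a * a) := apply_nonneg _ _
      rw [← Real.le_sqrt (apply_nonneg _ _) h0]
      refine ciSup_le fun p => Real.le_sqrt_of_sq_le ?_
      rw [← p.2.star_mul_self]
      exact le_universal p _
  le_norm a := ciSup_le fun p => p.2.le_norm a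

variable {B} in
theorem IsCStarSeminorm.le_star {p : Seminorm ℂ B} (hp : IsCStarSeminorm p) (a : B) :
    p a ≤ p (star a) := by
  have h := hp.mul_le (star a) a
  rw [hp.star_mul_self, sq] at h
  rcases (apply_nonneg p a).eq_or_lt with h0 | h0
  · rw [← h0]; exact apply_nonneg _ _
  · exact le_of_mul_le_mul_right h h0

/-- The algebra `B` with its universal `C*`-seminorm in place of its norm. -/
def PreEnveloping : Type w := B

namespace PreEnveloping

instance : Ring (PreEnveloping B) := inferInstanceAs (Ring B)

instance : StarRing (PreEnveloping B) := inferInstanceAs (StarRing B)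

instance : Algebra ℂ (PreEnveloping B) := inferInstanceAs (Algebra ℂ B)

instance : StarModule ℂ (PreEnveloping B) := inferInstanceAs (StarModule ℂ B)

instance : SeminormedRing (PreEnveloping B) where
  __ : Ring (PreEnveloping B) := inferInstance
  __ : SeminormedAddCommGroup (PreEnveloping B) :=
    (universalSeminorm B).toAddGroupSeminorm.toSeminormedAddCommGroup
  norm_mul_le := (isCStarSeminorm_universal B).mul_le

variable {B} in
theorem norm_def (b : PreEnveloping B) : ‖b‖ = universalSeminorm B b := rfl

instance : NormedAlgebra ℂ (PreEnveloping B) where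
  norm_smul_le c b := (map_smul_eq_mul (universalSeminorm B) c b).le

instance : NormedStarGroup (PreEnveloping B) where
  norm_star_le b := by
    have h := (isCStarSeminorm_universal B).le_star (star b : B)
    rwa [show star (star b : B) = b from star_star (R := B) b] at h

theorem norm_star_mul_self (b : PreEnveloping B) : ‖star b * b‖ = ‖b‖ ^ 2 :=
  (isCStarSeminorm_universal B).star_mul_self b

end PreEnveloping

/-- The enveloping `C*`-algebra of `B`: the Hausdorff completion of `B` with respect to its
universal `C*`-seminorm. -/
def Enveloping : Type w := UniformSpace.Completion (PreEnveloping B)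

namespace Enveloping

open UniformSpace

instance : NormedRing (Enveloping B) :=
  inferInstanceAs (NormedRing (Completion (PreEnveloping B)))

instance : NormedAlgebra ℂ (Enveloping B) where
  __ := (inferInstance : Algebra ℂ (Completion (PreEnveloping B)))
  norm_smul_le := norm_smul_le (α := ℂ) (β := Completion (PreEnveloping B))

instance : CompleteSpace (Enveloping B) :=
  inferInstanceAs (CompleteSpace (Completion (PreEnveloping B)))

variable {B} in
/-- The canonical map of `B` into the completion, as a bare function. -/
def of (b : B) : Enveloping B := ((show PreEnveloping B from b : PreEnveloping B) :
  Completion (PreEnveloping B))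

variable {B} in
theorem induction {P : Enveloping B → Prop} (x : Enveloping B) (hP : IsClosed {x | P x})
    (h : ∀ b : B, P (of b)) : P x :=
  Completion.induction_on (α := PreEnveloping B) x hP h

theorem uniformContinuous_star : UniformContinuous (star : PreEnveloping B → PreEnveloping B) :=
  (AddMonoidHomClass.isometry_of_norm (starAddEquiv : PreEnveloping B ≃+ PreEnveloping B)
    fun b => norm_star b).uniformContinuous

instance : Star (Enveloping B) :=
  ⟨Completion.map (star : PreEnveloping B → PreEnveloping B)⟩

variable {B} in
theorem of_add (a b : B) : of (a + b) = of a + of b :=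
  Completion.coe_add (α := PreEnveloping B) a b

variable {B} in
theorem of_mul (a b : B) : of (a * b) = of a * of b :=
  Completion.coe_mul (α := PreEnveloping B) a b

variable {B} in
theorem of_smul (c : ℂ) (b : B) : of (c • b) = c • of b :=
  Completion.coe_smul (X := PreEnveloping B) c b

variable {B} in
theorem of_star (b : B) : of (star b) = star (of b) :=
  (Completion.map_coe (uniformContinuous_star B) _).symm

variable {B} in
theorem norm_of (b : B) : ‖of b‖ = universalSeminorm B b :=
  Completion.norm_coe (E := PreEnveloping B) b

variable {B} in
theorem denseRange_of : DenseRange (of : B → Enveloping B) :=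
  Completion.denseRange_coe (α := PreEnveloping B)

theorem continuous_star' : Continuous (star : Enveloping B → Enveloping B) :=
  Completion.continuous_map

instance : ContinuousStar (Enveloping B) := ⟨continuous_star' B⟩

instance : InvolutiveStar (Enveloping B) where
  star_involutive x := by
    refine induction x (P := fun x => star (star x) = x)
      (isClosed_eq (by fun_prop) (by fun_prop)) fun b => ?_
    rw [← of_star, ← of_star, star_star]

instance : StarRing (Enveloping B) where
  star_mul x y := by
    refine induction x (P := fun x => star (x * y) = star y * star x)
      (isClosed_eq (by fun_prop) (by fun_prop)) fun a => ?_
    refine induction y (P := fun y => star (of a * y) = star y * star (of a))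
      (isClosed_eq (by fun_prop) (by fun_prop)) fun b => ?_
    rw [← of_mul, ← of_star, ← of_star, ← of_star, ← of_mul, star_mul]
  star_add x y := by
    refine induction x (P := fun x => star (x + y) = star x + star y)
      (isClosed_eq (by fun_prop) (by fun_prop)) fun a => ?_
    refine induction y (P := fun y => star (of a + y) = star (of a) + star y)
      (isClosed_eq (by fun_prop) (by fun_prop)) fun b => ?_
    rw [← of_add, ← of_star, ← of_star, ← of_star, ← of_add, star_add]

instance : StarModule ℂ (Enveloping B) where
  star_smul c x := by
    refine induction x (P := fun x => star (c • x) = star c • star x)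
      (isClosed_eq ((continuous_star' B).comp (continuous_const_smul c))
        ((continuous_star' B).const_smul (star c))) fun b => ?_
    rw [← of_smul, ← of_star, ← of_star, ← of_smul, star_smul]

instance : CStarRing (Enveloping B) where
  norm_mul_self_le x := by
    refine induction x (P := fun x => ‖x‖ * ‖x‖ ≤ ‖star x * x‖)
      (isClosed_le (by fun_prop) (by fun_prop)) fun b => ?_
    rw [← of_star, ← of_mul, norm_of, norm_of, (isCStarSeminorm_universal B).star_mul_self, sq]

instance : CStarAlgebra (Enveloping B) where

/-- The canonical `*`-homomorphism of `B` into its enveloping `C*`-algebra. -/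
def ι : B →⋆ₐ[ℂ] Enveloping B where
  toFun := of
  map_one' := Completion.coe_one (PreEnveloping B)
  map_mul' := of_mul
  map_zero' := Completion.coe_zero (α := PreEnveloping B)
  map_add' := of_add
  commutes' c := (Completion.algebraMap_def (PreEnveloping B) ℂ c).symm
  map_star' := of_star

end Enveloping

end Enveloping

/-! ### The twisted crossed product and the ideals coming from invariant ideals -/

namespace TwistedSystem

variable {G : Type u} {A : Type v} [Group G] [CStarAlgebra A] (S : TwistedSystem G A)

/-- The twisted crossed product `C*`-algebra: the enveloping `C*`-algebra of the twisted
`ℓ¹`-algebra of the system. -/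
abbrev CrossedProduct : Type (max u v) := Enveloping (L1 S.ops)

/-- The twisted `ℓ¹`-algebra as a `*`-subalgebra of the crossed product. -/
def l1Subalgebra : StarSubalgebra ℂ S.CrossedProduct := (Enveloping.ι (L1 S.ops)).range

/-- A closed self-adjoint two-sided ideal `J` of `A` with `α_x(J) ⊆ J` for all `x`. -/
structure InvariantIdeal where
  ideal : Ideal A
  isTwoSided : ideal.IsTwoSided
  isClosed : IsClosed (ideal : Set A)
  star_mem : ∀ a ∈ ideal, star a ∈ ideal
  α_mem : ∀ x, ∀ a ∈ ideal, S.α x a ∈ ideal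

variable {S} (J : S.InvariantIdeal)

/-- `ℓ¹(G; J)` as a left ideal of the twisted `ℓ¹`-algebra with values in `A`. -/
def InvariantIdeal.l1Ideal : Ideal (L1 S.ops) where
  carrier := {f | ∀ x, f x ∈ J.ideal}
  add_mem' hf hg x := J.ideal.add_mem (hf x) (hg x)
  zero_mem' _ := J.ideal.zero_mem
  smul_mem' g f hf x := by
    have := J.isTwoSided
    rw [smul_eq_mul, S.mul_apply]
    exact tsum_mem J.isClosed fun y =>
      J.ideal.mul_mem_right _ (J.ideal.mul_mem_left _ (J.α_mem _ _ (hf _)))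

instance : J.l1Ideal.IsTwoSided where
  mul_mem_of_left {f} g hf x := by
    have := J.isTwoSided
    rw [S.mul_apply]
    exact tsum_mem J.isClosed fun y =>
      J.ideal.mul_mem_right _ (J.ideal.mul_mem_right _ (hf _))

/-- The crossed product of `J`, as an ideal of the crossed product of `A`: the closure of the
image of `ℓ¹(G; J)`. -/
def InvariantIdeal.crossedIdeal : Ideal S.CrossedProduct where
  carrier := closure (Enveloping.ι (L1 S.ops) '' {f | ∀ x, f x ∈ J.ideal})
  add_mem' {a b} ha hb := by
    refine map_mem_closure₂ continuous_add ha hb ?_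
    rintro _ ⟨f, hf, rfl⟩ _ ⟨g, hg, rfl⟩
    exact ⟨f + g, J.l1Ideal.add_mem hf hg, map_add _ _ _⟩
  zero_mem' := subset_closure ⟨0, J.l1Ideal.zero_mem, map_zero _⟩
  smul_mem' c a ha := by
    refine Enveloping.induction c (P := fun c => c * a ∈
      closure (Enveloping.ι (L1 S.ops) '' {f | ∀ x, f x ∈ J.ideal}))
      (isClosed_closure.preimage (continuous_mul_const a)) fun g => ?_
    refine map_mem_closure (continuous_const_mul _) ha ?_
    rintro _ ⟨f, hf, rfl⟩
    exact ⟨g * f, J.l1Ideal.mul_mem_left g hf, map_mul _ _ _⟩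

instance : J.crossedIdeal.IsTwoSided where
  mul_mem_of_left {a} c ha := by
    refine Enveloping.induction c (P := fun c => a * c ∈ J.crossedIdeal)
      (isClosed_closure.preimage (continuous_const_mul a)) fun g => ?_
    refine map_mem_closure (f := fun a => a * Enveloping.of g) (continuous_mul_const _) ha ?_
    rintro _ ⟨f, hf, rfl⟩
    exact ⟨f * g, J.l1Ideal.mul_mem_right g hf, map_mul _ _ _⟩

end TwistedSystem

/-! ### Inverse closedness -/

/-- The subalgebra `D` of `C` is inverse closed: elements of `D` that are invertible in `C` have
their inverse in `D`. -/
def IsInverseClosed {C : Type w} [Ring C] [Algebra ℂ C] (D : Subalgebra ℂ C) : Prop :=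
  ∀ c : Cˣ, (c : C) ∈ D → ((c⁻¹ : Cˣ) : C) ∈ D

/-- The subalgebra `D` of `C` is inverse closed modulo the ideal `I`: whenever `f ∈ D` has a
two-sided inverse `g ∈ C` modulo `I`, some element of `D` is congruent to `g` modulo `I`. -/
def IsInverseClosedMod {C : Type w} [Ring C] [Algebra ℂ C] (D : Subalgebra ℂ C)
    (I : Ideal C) : Prop :=
  ∀ f ∈ D, ∀ g : C, f * g - 1 ∈ I → g * f - 1 ∈ I → ∃ g' ∈ D, g' - g ∈ I

end TwistedCrossed

end

/-! The heart of the matter is that the twisted `ℓ¹`-algebra R is hermitian: its self-adjoint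
elements have real spectrum. Write C for the crossed product and aδ_x for the delta function at x
with value a. The map `untwist` sends f to the C-valued function x ↦ f(x)δ_x. The twist is already
built into the multiplication of these values in C, so the target is the plain algebra ℓ¹(G; C),
where rigid symmetry applies: a self-adjoint h has h² = h*h, whose spectrum is non-negative, so that
of h is real. The map is isometric because ‖aδ_x‖ = ‖a‖ in C. This is seen without representations:
f ↦ f(1) is a positive A-valued map, the best bounds of left multiplication for its A-valued form
are a `C*`-seminorm (`PositiveMap.seminorm`), and that seminorm is at least ‖a‖ at aδ_x. As a real
spectrum has no holes, it does not change on passing from ℓ¹(G; C) back to the closed subalgebra R.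

In a hermitian Banach `*`-algebra, Pták's theory gives r(a)² ≤ r(a*a) for the spectral radius r and
shows that a ↦ r(a*a)^{1/2} is a `C*`-seminorm (`IsHermitianAlgebra.isCStarSeminorm_ptak`). So the
universal `C*`-seminorm dominates r. Being hermitian passes to the quotient R/I by I = ℓ¹(G; J).

Now let f have an inverse g in C modulo the closure of the image of I. Approximate g by h ∈ R. Then
for some j ∈ I the element 1 + j - fh has universal seminorm less than 1, hence spectral radius less
than 1 in R/I, so fh is a unit there; likewise hf. Thus f is invertible in R/I, and any lift k of
its inverse is congruent to g. Only the inclusion of the image of I in the crossed ideal is used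
here, never a description of which elements of R land in that ideal. -/

namespace TwistedCrossed

/-! ### The real-valued spectral radius -/

section SpectralRadius

variable {R : Type w} [NormedRing R] [NormedAlgebra ℂ R]

/-- The spectral radius as a real number. -/
noncomputable def specRadius (a : R) : ℝ := (spectralRadius ℂ a).toReal

theorem specRadius_nonneg (a : R) : 0 ≤ specRadius a := ENNReal.toReal_nonneg

theorem specRadius_le {a : R} {t : ℝ} (ht : 0 ≤ t) (h : ∀ z ∈ spectrum ℂ a, ‖z‖ ≤ t) :
    specRadius a ≤ t := by
  refine ENNReal.toReal_le_of_le_ofReal ht (iSup₂_le fun z hz => ?_)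
  change ‖z‖ₑ ≤ _
  rw [← ofReal_norm]
  exact ENNReal.ofReal_le_ofReal (h z hz)

variable [CompleteSpace R]

theorem spectralRadius_ne_top (a : R) : spectralRadius ℂ a ≠ ⊤ := by
  -- The factor ‖1‖ appears because the norm of the unit is not assumed to be 1. Finiteness matters
  -- since `toReal` would turn ⊤ into 0.
  refine ne_top_of_le_ne_top (b := ENNReal.ofReal (‖a‖ * ‖(1 : R)‖)) ENNReal.ofReal_ne_top
    (iSup₂_le fun z hz => ?_)
  change ‖z‖ₑ ≤ _
  rw [← ofReal_norm]
  exact ENNReal.ofReal_le_ofReal (spectrum.norm_le_norm_mul_of_mem hz)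

theorem norm_le_specRadius {a : R} {z : ℂ} (hz : z ∈ spectrum ℂ a) : ‖z‖ ≤ specRadius a := by
  rw [specRadius, ← ENNReal.ofReal_le_iff_le_toReal (spectralRadius_ne_top a),
    ofReal_norm]
  exact le_iSup₂ (f := fun (k : ℂ) (_ : k ∈ spectrum ℂ a) => (‖k‖₊ : ENNReal)) z hz

theorem tendsto_specRadius (a : R) :
    Filter.Tendsto (fun n : ℕ => ‖a ^ n‖ ^ (1 / n : ℝ)) Filter.atTop (nhds (specRadius a)) := by
  have h := (ENNReal.tendsto_toReal (spectralRadius_ne_top a)).comp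
    (spectrum.pow_norm_pow_one_div_tendsto_nhds_spectralRadius a)
  refine h.congr fun n => ?_
  simp only [Function.comp]
  rw [ENNReal.toReal_ofReal (by positivity)]

/-- Gelfand's formula gives the sharp bound even when ‖1‖ > 1, because ‖a ^ n‖ ≤ ‖a‖ ^ n for n > 0.
-/
theorem specRadius_le_norm (a : R) : specRadius a ≤ ‖a‖ := by
  refine le_of_tendsto (tendsto_specRadius a) ?_
  filter_upwards [Filter.eventually_gt_atTop 0] with n hn
  rw [one_div, Real.rpow_inv_le_iff_of_pos (norm_nonneg _) (norm_nonneg _) (by positivity)]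
  simpa using norm_pow_le' a hn

theorem isUnit_sub_of_specRadius_lt {a : R} {z : ℂ} (h : specRadius a < ‖z‖) :
    IsUnit (algebraMap ℂ R z - a) := by
  by_contra hz
  exact (norm_le_specRadius (a := a) hz).not_gt h

theorem isUnit_one_sub_of_specRadius_lt {a : R} (h : specRadius a < 1) : IsUnit (1 - a) := by
  simpa using isUnit_sub_of_specRadius_lt (a := a) (z := 1) (by simpa using h)

/-- The spectra of ab and ba agree away from 0. -/
theorem specRadius_mul_comm (a b : R) : specRadius (a * b) = specRadius (b * a) := by
  have key : ∀ a b : R, specRadius (a * b) ≤ specRadius (b * a) := fun a b => by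
    refine specRadius_le (specRadius_nonneg _) fun z hz => ?_
    rcases eq_or_ne z 0 with rfl | h0
    · simpa using specRadius_nonneg _
    · have : z ∈ spectrum ℂ (a * b) \ {0} := ⟨hz, h0⟩
      rw [spectrum.nonzero_mul_comm] at this
      exact norm_le_specRadius this.1
  exact le_antisymm (key a b) (key b a)

theorem specRadius_sq (a : R) : specRadius (a ^ 2) = specRadius a ^ 2 := by
  cases subsingleton_or_nontrivial R
  · have h (x : R) : specRadius x = 0 :=
      le_antisymm (specRadius_le le_rfl (by simp [spectrum.of_subsingleton])) (specRadius_nonneg x)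
    simp [h]
  apply le_antisymm
  · refine specRadius_le (sq_nonneg _) fun z hz => ?_
    rw [spectrum.map_pow] at hz
    obtain ⟨y, hy, rfl⟩ := hz
    simp only [norm_pow]
    exact pow_le_pow_left₀ (norm_nonneg _) (norm_le_specRadius hy) 2
  · rw [← Real.le_sqrt (specRadius_nonneg _) (specRadius_nonneg _)]
    refine specRadius_le (Real.sqrt_nonneg _) fun z hz => Real.le_sqrt_of_sq_le ?_
    rw [← norm_pow]
    refine norm_le_specRadius ?_
    rw [spectrum.map_pow]
    exact ⟨z, hz, rfl⟩

theorem specRadius_smul_le (c : ℂ) (a : R) : specRadius (c • a) ≤ ‖c‖ * specRadius a := by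
  refine specRadius_le (mul_nonneg (norm_nonneg _) (specRadius_nonneg _)) fun z hz => ?_
  by_contra! h
  rcases eq_or_ne c 0 with rfl | hc
  · rw [norm_zero, zero_mul] at h
    refine hz ?_
    rw [zero_smul, spectrum.mem_resolventSet_iff, sub_zero]
    exact (IsUnit.mk0 z (norm_pos_iff.mp h)).map (algebraMap ℂ R)
  · have h1 : z = (Units.mk0 c hc) • (c⁻¹ * z) := by
      simp [Units.smul_def, hc]
    rw [show c • a = (Units.mk0 c hc) • a from rfl, h1, spectrum.smul_mem_smul_iff] at hz
    have := norm_le_specRadius hz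
    rw [norm_mul, norm_inv, inv_mul_le_iff₀ (norm_pos_iff.mpr hc)] at this
    exact this.not_gt h

theorem specRadius_smul (c : ℂ) (a : R) : specRadius (c • a) = ‖c‖ * specRadius a := by
  refine le_antisymm (specRadius_smul_le c a) ?_
  rcases eq_or_ne c 0 with rfl | hc
  · simpa using specRadius_nonneg _
  · have := specRadius_smul_le c⁻¹ (c • a)
    rwa [smul_smul, inv_mul_cancel₀ hc, one_smul, norm_inv, ← div_eq_inv_mul,
      le_div_iff₀ (norm_pos_iff.mpr hc), mul_comm] at this

theorem specRadius_neg (a : R) : specRadius (-a) = specRadius a := by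
  simpa using specRadius_smul (-1) a

end SpectralRadius

/-! ### Square roots -/

section SquareRoot

/-- In the descending product each factor satisfies |1/2 - n| ≤ n + 1, so n! bounds the whole. This
dominates the binomial series of (1 - a)^{1/2} by ∑ ‖a ^ n‖. -/
theorem abs_choose_half_le (n : ℕ) : |Ring.choose (1 / 2 : ℝ) n| ≤ 1 := by
  have h : |(descPochhammer ℤ n).smeval (1 / 2 : ℝ)| ≤ n.factorial := by
    induction n with
    | zero => simp
    | succ n ih =>
      rw [descPochhammer_succ_right, Polynomial.smeval_mul, abs_mul, Nat.factorial_succ, mul_comm]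
      push_cast
      refine mul_le_mul ?_ ih (abs_nonneg _) (by positivity)
      have : (0 : ℝ) ≤ n := n.cast_nonneg
      simp only [Polynomial.smeval_sub, Polynomial.smeval_X, Polynomial.smeval_natCast, pow_one,
        pow_zero, nsmul_eq_mul, mul_one]
      rw [abs_le]
      constructor <;> linarith
  rw [Ring.descPochhammer_eq_factorial_smul_choose, nsmul_eq_mul, abs_mul, Nat.abs_cast] at h
  exact le_of_mul_le_mul_left (by simpa using h) (Nat.cast_pos.mpr n.factorial_pos)

theorem sum_choose_half_mul (n : ℕ) :
    ∑ p ∈ Finset.HasAntidiagonal.antidiagonal n, Ring.choose (1 / 2 : ℝ) p.1 * Ring.choose (1 / 2 : ℝ) p.2 =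
      Ring.choose (1 : ℝ) n := by
  rw [← Ring.add_choose_eq n (Commute.all _ _)]
  norm_num

variable {R : Type w} [NormedRing R] [NormedAlgebra ℂ R] [CompleteSpace R]

theorem summable_norm_pow_of_specRadius_lt {a : R} (h : specRadius a < 1) :
    Summable fun n : ℕ => ‖a ^ n‖ := by
  obtain ⟨t, ht, ht1⟩ := exists_between h
  have h0 : 0 ≤ t := (specRadius_nonneg a).trans ht.le
  refine Summable.of_norm_bounded_eventually_nat (summable_geometric_of_lt_one h0 ht1) ?_
  filter_upwards [(tendsto_specRadius a).eventually_lt_const ht, Filter.eventually_gt_atTop 0]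
    with n hn hn0
  rw [one_div, Real.rpow_inv_lt_iff_of_pos (norm_nonneg _) h0 (by positivity)] at hn
  simpa using hn.le

variable [StarRing R] [StarModule ℂ R] [NormedStarGroup R]

/-- If `a` is self-adjoint with spectral radius less than one, then `1 - a` has a self-adjoint
square root. -/
theorem exists_isSelfAdjoint_mul_self_eq {a : R} (ha : IsSelfAdjoint a) (h : specRadius a < 1) :
    ∃ w : R, IsSelfAdjoint w ∧ w * w = 1 - a := by
  let f : ℕ → R := fun n => ((Ring.choose (1 / 2 : ℝ) n : ℝ) : ℂ) • (-a) ^ n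
  have hf : Summable fun n => ‖f n‖ := by
    refine Summable.of_nonneg_of_le (fun _ => norm_nonneg _) (fun n => ?_)
      (summable_norm_pow_of_specRadius_lt (a := -a) (by rwa [specRadius_neg]))
    rw [norm_smul, Complex.norm_real, Real.norm_eq_abs]
    exact mul_le_of_le_one_left (norm_nonneg _) (abs_choose_half_le n)
  refine ⟨∑' n, f n, ?_, ?_⟩
  · rw [IsSelfAdjoint, tsum_star]
    refine tsum_congr fun n => ?_
    simp [f, star_smul, ha.star_eq]
  -- By Vandermonde the Cauchy square has coefficients `Ring.choose 1 n`, which vanish for n ≥ 2;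
  -- the terms n = 0, 1 give 1 - a.
  · rw [tsum_mul_tsum_eq_tsum_sum_antidiagonal_of_summable_norm hf hf]
    have : ∀ n, ∑ p ∈ Finset.HasAntidiagonal.antidiagonal n, f p.1 * f p.2 =
        ((Ring.choose (1 : ℝ) n : ℝ) : ℂ) • (-a) ^ n := fun n => by
      rw [← sum_choose_half_mul, Complex.ofReal_sum, Finset.sum_smul]
      refine Finset.sum_congr rfl fun p hp => ?_
      rw [← Finset.HasAntidiagonal.mem_antidiagonal.mp hp, pow_add]
      simp only [f, smul_mul_smul_comm, Complex.ofReal_mul]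
    simp_rw [this]
    rw [tsum_eq_sum (s := Finset.range 2)]
    · simp [Finset.sum_range_succ, sub_eq_add_neg]
    · intro n hn
      have : Ring.choose (1 : ℝ) n = 0 := by
        rw [← Nat.cast_one, Ring.choose_natCast, Nat.choose_eq_zero_of_lt (by simpa using hn)]
        simp
      rw [this]; simp

end SquareRoot

/-! ### Hermitian Banach `*`-algebras -/

/-- A unital complex `*`-algebra is hermitian if its self-adjoint elements have real spectrum. -/
def IsHermitianAlgebra (R : Type w) [Ring R] [Algebra ℂ R] [Star R] : Prop :=
  ∀ h : R, IsSelfAdjoint h → ∀ z ∈ spectrum ℂ h, z.im = 0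

section SpectralShift

variable {R : Type w} [Ring R] [Algebra ℂ R]

theorem mem_spectrum_sub {a : R} {z : ℂ} (hz : z ∈ spectrum ℂ a) (s : ℂ) :
    s - z ∈ spectrum ℂ (algebraMap ℂ R s - a) := by
  rw [← spectrum.singleton_sub_eq]
  exact Set.sub_mem_sub rfl hz

theorem mem_spectrum_of_sub {a : R} {z s : ℂ} (hz : z ∈ spectrum ℂ (algebraMap ℂ R s - a)) :
    s - z ∈ spectrum ℂ a := by
  simpa using mem_spectrum_sub hz s

end SpectralShift

namespace IsHermitianAlgebra

variable {R : Type w} [NormedRing R] [NormedAlgebra ℂ R] [CompleteSpace R]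
variable [StarRing R] [StarModule ℂ R]

/-! ### Pták's inequality and submultiplicativity of the spectral radius -/

section Ptak

variable [NormedStarGroup R] (H : IsHermitianAlgebra R)
include H

-- Since w is invertible, w² + c = w(1 + d)w with d = w⁻¹cw⁻¹ skew-adjoint. Then i·d is self-adjoint
-- and has real spectrum, so -1 is not in the spectrum of d.
omit [NormedStarGroup R] in
theorem isUnit_add_mul_sub {a b w : R} (hw : IsSelfAdjoint w) (hw2 : w * w = 1 - b)
    (hb : specRadius b < 1) {c : R} (hc : star c = -c) (hab : a = w * w + c) : IsUnit a := by
  have hu : IsUnit w := by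
    have h1 : IsUnit (w * w) := hw2 ▸ isUnit_one_sub_of_specRadius_lt hb
    exact (Commute.isUnit_mul_iff (Commute.refl w)).mp h1 |>.1
  obtain ⟨u, rfl⟩ := hu
  have hus : star (↑u⁻¹ : R) = ↑u⁻¹ := by
    have : star u = u := Units.ext hw
    rw [← Units.coe_star, star_inv, this]
  set d : R := ↑u⁻¹ * c * ↑u⁻¹ with hd
  have hd1 : IsUnit (1 + d) := by
    have hsa : IsSelfAdjoint (Complex.I • d) := by
      rw [IsSelfAdjoint, star_smul, hd, star_mul, star_mul, hus, hc]
      simp [mul_assoc]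
    have : Complex.I ∉ spectrum ℂ (-(Complex.I • d)) := fun h => by
      have := H _ hsa.neg _ h
      simp at this
    have h2 : algebraMap ℂ R Complex.I - -(Complex.I • d) =
        algebraMap ℂ R Complex.I * (1 + d) := by
      rw [mul_add, mul_one, Algebra.algebraMap_eq_smul_one, smul_one_mul, sub_neg_eq_add]
    rw [spectrum.notMem_iff, h2] at this
    have h3 : IsUnit (algebraMap ℂ R Complex.I) :=
      (IsUnit.mk0 _ Complex.I_ne_zero).map (algebraMap ℂ R)
    obtain ⟨i, hi⟩ := h3
    rw [← hi] at this
    exact (Units.isUnit_units_mul i _).mp this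
  have : a = u * (1 + d) * u := by
    rw [hab, hd]; simp [mul_add, add_mul, mul_assoc]
  rw [this]
  exact (u.isUnit.mul hd1).mul u.isUnit

/-- The product (1 + a*)(1 - a) = (1 - a*a) + (a* - a) is a square plus a skew-adjoint element,
hence a unit, which gives a left inverse of 1 - a. The opposite order, with aa*, gives a right
inverse. -/
theorem isUnit_one_sub {a : R} (h : specRadius (star a * a) < 1) : IsUnit (1 - a) := by
  have h' : specRadius (a * star a) < 1 := by rwa [specRadius_mul_comm]
  obtain ⟨w, hw, hw2⟩ := exists_isSelfAdjoint_mul_self_eq (IsSelfAdjoint.star_mul_self a) h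
  obtain ⟨v, hv, hv2⟩ := exists_isSelfAdjoint_mul_self_eq (IsSelfAdjoint.mul_star_self a) h'
  have h1 : IsUnit ((1 + star a) * (1 - a)) :=
    H.isUnit_add_mul_sub hw hw2 h (c := star a - a) (by simp)
      (by rw [hw2]; noncomm_ring)
  have h2 : IsUnit ((1 - a) * (1 + star a)) :=
    H.isUnit_add_mul_sub hv hv2 h' (c := star a - a) (by simp)
      (by rw [hv2]; noncomm_ring)
  obtain ⟨x, hx⟩ := h1.exists_left_inv
  obtain ⟨y, hy⟩ := h2.exists_right_inv
  refine isUnit_iff_exists_and_exists.mpr ⟨⟨_, (mul_assoc _ _ _).symm.trans hy⟩,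
    ⟨x * (1 + star a), (mul_assoc _ _ _).trans hx⟩⟩

theorem specRadius_sq_le (a : R) : specRadius a ^ 2 ≤ specRadius (star a * a) := by
  rw [← Real.le_sqrt (specRadius_nonneg _) (specRadius_nonneg _)]
  refine specRadius_le (Real.sqrt_nonneg _) fun z hz => ?_
  by_contra! hlt
  have h0 : 0 < ‖z‖ := (Real.sqrt_nonneg _).trans_lt hlt
  have hz0 : z ≠ 0 := norm_pos_iff.mp h0
  rw [Real.sqrt_lt' h0] at hlt
  have : IsUnit (1 - z⁻¹ • a) := H.isUnit_one_sub (by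
    rw [star_smul, smul_mul_smul_comm, specRadius_smul]
    simp only [RCLike.star_def, norm_mul, RCLike.norm_conj, norm_inv]
    rw [← mul_inv, inv_mul_lt_iff₀ (by positivity)]
    linarith)
  apply hz
  have h2 : algebraMap ℂ R z - a = algebraMap ℂ R z * (1 - z⁻¹ • a) := by
    rw [mul_sub, mul_one, Algebra.algebraMap_eq_smul_one, smul_one_mul, smul_smul,
      mul_inv_cancel₀ hz0, one_smul]
  rw [spectrum.mem_resolventSet_iff, h2]
  exact ((IsUnit.mk0 z hz0).map (algebraMap ℂ R)).mul this

/-- Each doubling uses Pták's inequality for x = hᵐkᵐ: r(x)² ≤ r(kᵐh²ᵐkᵐ) = r(h²ᵐk²ᵐ), by cyclicity.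
-/
theorem specRadius_mul_pow_le {h k : R} (hh : IsSelfAdjoint h) (hk : IsSelfAdjoint k) (n : ℕ) :
    specRadius (h * k) ^ (2 ^ n) ≤ specRadius (h ^ (2 ^ n) * k ^ (2 ^ n)) := by
  induction n with
  | zero => simp
  | succ n ih =>
    rw [pow_succ, pow_mul, pow_mul, pow_mul]
    refine (pow_le_pow_left₀ (pow_nonneg (specRadius_nonneg _) _) ih 2).trans
      ((H.specRadius_sq_le _).trans ?_)
    rw [star_mul, (hh.pow _).star_eq, (hk.pow _).star_eq, mul_assoc, specRadius_mul_comm, sq, sq]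
    simp only [mul_assoc, le_refl]

/-- Bound the right side of `specRadius_mul_pow_le` by norms, take 2ⁿ-th roots and apply Gelfand's
formula to h and k separately. -/
theorem specRadius_mul_le {h k : R} (hh : IsSelfAdjoint h) (hk : IsSelfAdjoint k) :
    specRadius (h * k) ≤ specRadius h * specRadius k := by
  have ht : Filter.Tendsto (fun n : ℕ => 2 ^ n) Filter.atTop Filter.atTop :=
    tendsto_pow_atTop_atTop_of_one_lt one_lt_two
  refine ge_of_tendsto' (((tendsto_specRadius h).mul (tendsto_specRadius k)).comp ht) fun n => ?_
  simp only [Function.comp]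
  rw [← Real.mul_rpow (norm_nonneg _) (norm_nonneg _), one_div,
    Real.le_rpow_inv_iff_of_pos (specRadius_nonneg _) (by positivity) (by positivity)]
  rw [Real.rpow_natCast]
  exact (H.specRadius_mul_pow_le hh hk n).trans
    ((specRadius_le_norm _).trans (norm_mul_le _ _))

end Ptak

/-- The self-adjoint elements with non-negative spectrum. -/
def IsPos (h : R) : Prop := IsSelfAdjoint h ∧ ∀ z ∈ spectrum ℂ h, 0 ≤ z.re ∧ z.im = 0

theorem isPos_algebraMap_sub (H : IsHermitianAlgebra R) {h : R} (hh : IsSelfAdjoint h) {t : ℝ}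
    (ht : specRadius h ≤ t) : IsPos (algebraMap ℂ R t - h) := by
  have hs : IsSelfAdjoint (algebraMap ℂ R t - h) := by
    refine IsSelfAdjoint.sub ?_ hh
    exact IsSelfAdjoint.algebraMap R (by simp [IsSelfAdjoint])
  refine ⟨hs, fun z hz => ⟨?_, H _ hs z hz⟩⟩
  have h1 := norm_le_specRadius (mem_spectrum_of_sub hz)
  have h2 := (Complex.re_le_norm _).trans (h1.trans ht)
  simpa using h2

omit [StarModule ℂ R] in
theorem isPos_sq (H : IsHermitianAlgebra R) {h : R} (hh : IsSelfAdjoint h) : IsPos (h ^ 2) := by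
  refine ⟨hh.pow 2, fun z hz => ?_⟩
  cases subsingleton_or_nontrivial R
  · simp [spectrum.of_subsingleton] at hz
  rw [spectrum.map_pow] at hz
  obtain ⟨y, hy, rfl⟩ := hz
  have := H h hh y hy
  simp only [sq, Complex.mul_re, Complex.mul_im, this]
  constructor
  · nlinarith [mul_self_nonneg y.re]
  · ring

omit [CompleteSpace R] in
theorem IsPos.smul {h : R} (hh : IsPos h) {t : ℝ} (ht : 0 < t) : IsPos ((t : ℂ) • h) := by
  have htc : (t : ℂ) ≠ 0 := by exact_mod_cast ht.ne'
  refine ⟨IsSelfAdjoint.smul (by simp [IsSelfAdjoint]) hh.1, fun z hz => ?_⟩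
  have h1 : z = (Units.mk0 (t : ℂ) htc) • ((t : ℂ)⁻¹ * z) := by
    simp [Units.smul_def, htc]
  rw [show (t : ℂ) • h = (Units.mk0 (t : ℂ) htc) • h from rfl, h1, spectrum.smul_mem_smul_iff] at hz
  have := hh.2 _ hz
  rw [← Complex.ofReal_inv, Complex.re_ofReal_mul, Complex.im_ofReal_mul] at this
  refine ⟨?_, ?_⟩
  · exact (mul_nonneg_iff_of_pos_left (inv_pos.mpr ht)).mp this.1
  · exact (mul_eq_zero.mp this.2).resolve_left (inv_pos.mpr ht).ne'

-- The spectrum of 1 - (1 + h)⁻¹ is obtained from that of h by s ↦ 1 - 1/(1 + s), which is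
-- increasing on [0, r(h)] and stays below 1.
omit [StarModule ℂ R] in
theorem IsPos.exists_inv {h : R} (hh : IsPos h) : ∃ u : Rˣ, (u : R) = 1 + h ∧
    IsSelfAdjoint (↑u⁻¹ : R) ∧ specRadius (1 - ↑u⁻¹ : R) < 1 := by
  have h1 : IsUnit (1 + h) := by
    have : (-1 : ℂ) ∉ spectrum ℂ h := fun h1 => by
      have := (hh.2 _ h1).1
      norm_num at this
    rw [spectrum.notMem_iff] at this
    simpa [add_comm] using this.neg
  obtain ⟨u, hu⟩ := h1
  have hus : star u = u := Units.ext (by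
    rw [Units.coe_star, hu, star_add, star_one, hh.1.star_eq])
  refine ⟨u, hu, ?_, ?_⟩
  · rw [IsSelfAdjoint, ← Units.coe_star, star_inv, hus]
  have hr := specRadius_nonneg h
  have key : ∀ z ∈ spectrum ℂ (1 - ↑u⁻¹ : R), ‖z‖ ≤ 1 - (1 + specRadius h)⁻¹ := by
    intro z hz
    have hz' := mem_spectrum_of_sub (a := (↑u⁻¹ : R)) (z := z) (s := 1) (by simpa using hz)
    have h0 : (1 - z) ≠ 0 := spectrum.ne_zero_of_mem_of_unit hz'
    have h3 : (1 - z)⁻¹ ∈ spectrum ℂ (u : R) := by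
      rw [spectrum.inv₀_mem_iff]; exact hz'
    rw [hu] at h3
    have h4 : (1 - z)⁻¹ - 1 ∈ spectrum ℂ h := by
      have := mem_spectrum_of_sub (a := -h) (s := 1) (z := (1 - z)⁻¹) (by simpa using h3)
      rw [← spectrum.neg_eq] at this
      simpa using this
    obtain ⟨h5, h6⟩ := hh.2 _ h4
    have h7 := norm_le_specRadius h4
    set s : ℝ := ((1 - z)⁻¹ - 1).re with hs
    have h8 : (1 - z)⁻¹ - 1 = (s : ℂ) := Complex.ext rfl (by simpa using h6)
    rw [h8, Complex.norm_real, Real.norm_eq_abs, abs_of_nonneg h5] at h7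
    have h9 : z = ((1 - (1 + s)⁻¹ : ℝ) : ℂ) := by
      have : (1 - z)⁻¹ = 1 + (s : ℂ) := by rw [← h8]; ring
      push_cast
      rw [← this, _root_.inv_inv]; ring
    rw [h9, Complex.norm_real, Real.norm_eq_abs, abs_of_nonneg]
    · gcongr
    · rw [sub_nonneg]
      exact inv_le_one_of_one_le₀ (by linarith)
  refine (specRadius_le ?_ key).trans_lt ?_
  · rw [sub_nonneg]
    exact inv_le_one_of_one_le₀ (by linarith)
  · rw [sub_lt_self_iff]
    positivity

/-! ### Positive elements form a cone; the Pták function -/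

section Cone

variable [NormedStarGroup R] (H : IsHermitianAlgebra R)
include H

/-- With p = 1 - (1 + h)⁻¹ and q = 1 - (1 + k)⁻¹ one has 1 + h + k = (1 + h)(1 - pq)(1 + k), and
r(pq) ≤ r(p)r(q) < 1. -/
theorem isUnit_one_add_add {h k : R} (hh : IsPos h) (hk : IsPos k) : IsUnit (1 + (h + k)) := by
  obtain ⟨u, hu, hus, hur⟩ := hh.exists_inv
  obtain ⟨v, hv, hvs, hvr⟩ := hk.exists_inv
  have h1 : specRadius ((1 - ↑u⁻¹ : R) * (1 - ↑v⁻¹ : R)) < 1 :=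
    (H.specRadius_mul_le ((IsSelfAdjoint.one R).sub hus) ((IsSelfAdjoint.one R).sub hvs)).trans_lt
      (mul_lt_one_of_nonneg_of_lt_one_left (specRadius_nonneg _) hur hvr.le)
  have h2 : (1 + (h + k)) = u * (1 - (1 - ↑u⁻¹ : R) * (1 - ↑v⁻¹ : R)) * v := by
    have e1 : (u : R) * (1 - ↑u⁻¹) = h := by rw [mul_sub, Units.mul_inv, hu]; simp
    have e2 : (1 - ↑v⁻¹) * (v : R) = k := by rw [sub_mul, Units.inv_mul, hv]; simp
    calc (1 + (h + k)) = u * v - h * k := by rw [hu, hv]; noncomm_ring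
      _ = u * v - (u * (1 - ↑u⁻¹)) * ((1 - ↑v⁻¹) * (v : R)) := by rw [e1, e2]
      _ = _ := by
        generalize (1 - ↑u⁻¹ : R) = p
        generalize (1 - ↑v⁻¹ : R) = q
        noncomm_ring
  rw [h2]
  exact (u.isUnit.mul (isUnit_one_sub_of_specRadius_lt h1)).mul v.isUnit

/-- A negative spectral value z would, after scaling by -1/z, contradict invertibility of 1 + h' +
k' for positive h', k'. -/
theorem isPos_add {h k : R} (hh : IsPos h) (hk : IsPos k) : IsPos (h + k) := by
  refine ⟨hh.1.add hk.1, fun z hz => ?_⟩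
  have him := H _ (hh.1.add hk.1) z hz
  refine ⟨?_, him⟩
  by_contra! hlt
  have ht : 0 < (-z.re)⁻¹ := inv_pos.mpr (by linarith)
  have h1 := H.isUnit_one_add_add (hh.smul ht) (hk.smul ht)
  apply hz
  have hz1 : z = ((z.re : ℝ) : ℂ) := Complex.ext rfl (by simpa using him)
  have hz0 : z ≠ 0 := fun h => by rw [h] at hlt; simp at hlt
  have h2 : algebraMap ℂ R z - (h + k) = algebraMap ℂ R z *
      (1 + ((((-z.re)⁻¹ : ℝ) : ℂ) • h + (((-z.re)⁻¹ : ℝ) : ℂ) • k)) := by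
    rw [Complex.ofReal_inv, Complex.ofReal_neg, ← hz1, Algebra.algebraMap_eq_smul_one,
      ← smul_add, smul_one_mul, smul_add, smul_smul, inv_neg, mul_neg, mul_inv_cancel₀ hz0,
      neg_one_smul, sub_eq_add_neg]
  rw [spectrum.mem_resolventSet_iff, h2]
  exact ((IsUnit.mk0 z hz0).map (algebraMap ℂ R)).mul h1

/-- Add the positive elements r(h) - h and r(k) - k; the lower bound comes from the same argument
for -h and -k. -/
theorem specRadius_add_le {h k : R} (hh : IsSelfAdjoint h) (hk : IsSelfAdjoint k) :
    specRadius (h + k) ≤ specRadius h + specRadius k := by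
  have key : ∀ {h k : R}, IsSelfAdjoint h → IsSelfAdjoint k → ∀ z ∈ spectrum ℂ (h + k),
      z.re ≤ specRadius h + specRadius k := by
    intro h k hh hk z hz
    have hp := H.isPos_add (H.isPos_algebraMap_sub hh le_rfl) (H.isPos_algebraMap_sub hk le_rfl)
    rw [show algebraMap ℂ R (specRadius h : ℂ) - h + (algebraMap ℂ R (specRadius k : ℂ) - k) =
      algebraMap ℂ R ((specRadius h : ℂ) + (specRadius k : ℂ)) - (h + k) by
      rw [map_add]; abel] at hp
    simpa using (hp.2 _ (mem_spectrum_sub hz _)).1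
  refine specRadius_le (add_nonneg (specRadius_nonneg _) (specRadius_nonneg _)) fun z hz => ?_
  have him := H _ (hh.add hk) z hz
  have hz1 : z = ((z.re : ℝ) : ℂ) := Complex.ext rfl (by simpa using him)
  rw [hz1, Complex.norm_real, Real.norm_eq_abs, abs_le]
  refine ⟨?_, key hh hk z hz⟩
  have hz' : -z ∈ spectrum ℂ (-h + -k) := by
    rw [← neg_add, ← spectrum.neg_eq]; simpa using hz
  have := key hh.neg hk.neg _ hz'
  rw [specRadius_neg, specRadius_neg, Complex.neg_re] at this
  linarith

theorem specRadius_le_add {h k : R} (hh : IsPos h) (hk : IsPos k) :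
    specRadius h ≤ specRadius (h + k) := by
  refine specRadius_le (specRadius_nonneg _) fun z hz => ?_
  have hz1 : z = ((z.re : ℝ) : ℂ) := Complex.ext rfl (by simpa using (hh.2 z hz).2)
  rw [hz1, Complex.norm_real, Real.norm_eq_abs, abs_of_nonneg (hh.2 z hz).1]
  have hp := H.isPos_add (H.isPos_algebraMap_sub (hh.1.add hk.1) le_rfl) hk
  rw [show algebraMap ℂ R (specRadius (h + k) : ℂ) - (h + k) + k =
    algebraMap ℂ R (specRadius (h + k) : ℂ) - h by abel] at hp
  simpa using (hp.2 _ (mem_spectrum_sub hz _)).1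

/-- The squares of x + x* and i(x - x*) are positive with sum 2(x*x + xx*), so monotonicity gives
r(x + x*)² ≤ 4r(x*x). -/
theorem specRadius_add_star_le (x : R) :
    specRadius (x + star x) ≤ 2 * √(specRadius (star x * x)) := by
  have hh : IsSelfAdjoint (x + star x) := IsSelfAdjoint.add_star_self x
  have hk : IsSelfAdjoint (Complex.I • (x - star x)) := by
    rw [IsSelfAdjoint, star_smul]
    simp [sub_eq_add_neg, add_comm]
  have h1 := H.specRadius_le_add (H.isPos_sq hh) (H.isPos_sq hk)
  have h2 : (x + star x) ^ 2 + (Complex.I • (x - star x)) ^ 2 =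
      (2 : ℂ) • (star x * x + x * star x) := by
    rw [smul_pow, Complex.I_sq, neg_one_smul, two_smul]
    noncomm_ring
  rw [h2, specRadius_smul, specRadius_sq] at h1
  have h3 := H.specRadius_add_le (IsSelfAdjoint.star_mul_self x) (IsSelfAdjoint.mul_star_self x)
  rw [specRadius_mul_comm x] at h3
  refine le_of_sq_le_sq (h1.trans ?_) (by positivity)
  rw [mul_pow, Real.sq_sqrt (specRadius_nonneg _)]
  norm_num
  linarith

/-- The Pták function `a ↦ r(a* a)^{1/2}` of a hermitian Banach `*`-algebra, as a seminorm. -/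
noncomputable def ptak : Seminorm ℂ R :=
  have hmul : ∀ a b : R, specRadius (star (a * b) * (a * b)) ≤
      specRadius (star a * a) * specRadius (star b * b) := fun a b => by
    rw [star_mul, mul_assoc, specRadius_mul_comm, specRadius_mul_comm (star b),
      show star a * (a * b) * star b = star a * a * (b * star b) by simp only [mul_assoc]]
    exact H.specRadius_mul_le (IsSelfAdjoint.star_mul_self a) (IsSelfAdjoint.mul_star_self b)
  Seminorm.of (fun a => √(specRadius (star a * a)))
    (fun a b => by
      refine Real.sqrt_le_iff.mpr ⟨by positivity, ?_⟩
      have e : star (a + b) * (a + b) =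
          (star a * a + star b * b) + (star a * b + star (star a * b)) := by
        simp only [star_add, star_mul, star_star]; noncomm_ring
      rw [e]
      refine (H.specRadius_add_le ((IsSelfAdjoint.star_mul_self a).add
        (IsSelfAdjoint.star_mul_self b)) (IsSelfAdjoint.add_star_self _)).trans ?_
      have h1 := H.specRadius_add_le (IsSelfAdjoint.star_mul_self a)
        (IsSelfAdjoint.star_mul_self b)
      -- The cross term is at most 2·r(a*a)^{1/2}·r(b*b)^{1/2}, which completes the square.
      have h2 := (H.specRadius_add_star_le (star a * b))
      have h3 := Real.sqrt_le_sqrt (hmul (star a) b)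
      rw [star_star, specRadius_mul_comm a, Real.sqrt_mul (specRadius_nonneg _)] at h3
      nlinarith [Real.sq_sqrt (specRadius_nonneg (star a * a)),
        Real.sq_sqrt (specRadius_nonneg (star b * b))])
    (fun c a => by
      rw [star_smul, smul_mul_smul_comm, specRadius_smul, Real.sqrt_mul (norm_nonneg _)]
      simp [← sq])

theorem ptak_apply (a : R) : H.ptak a = √(specRadius (star a * a)) := rfl

theorem specRadius_le_ptak (a : R) : specRadius a ≤ H.ptak a :=
  Real.le_sqrt_of_sq_le (H.specRadius_sq_le a)

/-- **Pták's theorem**: the Pták function of a hermitian Banach `*`-algebra is a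
`C*`-seminorm. -/
theorem isCStarSeminorm_ptak : IsCStarSeminorm H.ptak where
  mul_le a b := by
    simp only [ptak_apply]
    rw [← Real.sqrt_mul (specRadius_nonneg _)]
    refine Real.sqrt_le_sqrt ?_
    rw [star_mul, mul_assoc, specRadius_mul_comm, specRadius_mul_comm (star b),
      show star a * (a * b) * star b = star a * a * (b * star b) by simp only [mul_assoc]]
    exact H.specRadius_mul_le (IsSelfAdjoint.star_mul_self a) (IsSelfAdjoint.mul_star_self b)
  star_mul_self a := by
    simp only [ptak_apply]
    rw [(IsSelfAdjoint.star_mul_self a).star_eq, ← sq, specRadius_sq,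
      Real.sqrt_sq (specRadius_nonneg _), Real.sq_sqrt (specRadius_nonneg _)]
  le_norm a := by
    rw [ptak_apply]
    refine Real.sqrt_le_iff.mpr ⟨norm_nonneg _, (specRadius_le_norm _).trans ?_⟩
    simpa [sq] using norm_mul_le (star a) a

end Cone

end IsHermitianAlgebra

/-! ### The `C*`-seminorm of an operator-valued positive map -/

namespace PositiveMap

variable {R : Type w} [NormedRing R] [NormedAlgebra ℂ R] [StarRing R]
variable {A : Type v} [CStarAlgebra A] [PartialOrder A]

/-- The real numbers `t ≥ 0` for which left multiplication by `a` is bounded by `t` with respect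
to the `A`-valued form `(f, g) ↦ E (f* g)`. -/
def bounds (E : R →ₗ[ℂ] A) (a : R) : Set ℝ :=
  {t | 0 ≤ t ∧ ∀ g, E (star (a * g) * (a * g)) ≤ t ^ 2 • E (star g * g)}

/-- The least bound of left multiplication by `a`. -/
noncomputable def opSeminorm (E : R →ₗ[ℂ] A) (a : R) : ℝ := sInf (bounds E a)

variable {E : R →ₗ[ℂ] A}

theorem bddBelow_bounds (a : R) : BddBelow (bounds E a) := ⟨0, fun _ ht => ht.1⟩

theorem opSeminorm_le {a : R} {t : ℝ} (ht : t ∈ bounds E a) : opSeminorm E a ≤ t :=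
  csInf_le (bddBelow_bounds a) ht

theorem opSeminorm_nonneg (a : R) : 0 ≤ opSeminorm E a := Real.sInf_nonneg fun _ ht => ht.1

theorem zero_mem_bounds : 0 ∈ bounds E 0 := ⟨le_rfl, fun g => by simp⟩

variable [StarOrderedRing A]

theorem isClosed_bounds (a : R) : IsClosed (bounds E a) := by
  simp only [bounds, Set.ofPred_and, Set.ofPred_forall]
  refine (isClosed_le continuous_const continuous_id).inter (isClosed_iInter fun g => ?_)
  exact isClosed_le continuous_const ((continuous_pow 2).smul continuous_const)

theorem mul_mem_bounds {a b : R} {s t : ℝ} (hs : s ∈ bounds E a) (ht : t ∈ bounds E b) :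
    s * t ∈ bounds E (a * b) := by
  refine ⟨mul_nonneg hs.1 ht.1, fun g => ?_⟩
  rw [mul_assoc, mul_pow, mul_smul]
  exact (hs.2 _).trans (smul_le_smul_of_nonneg_left (ht.2 g) (by positivity))

section Smul

variable [StarModule ℂ R]

theorem smul_mem_bounds {a : R} {s : ℝ} (hs : s ∈ bounds E a) (c : ℂ) :
    ‖c‖ * s ∈ bounds E (c • a) := by
  refine ⟨mul_nonneg (norm_nonneg _) hs.1, fun g => ?_⟩
  have : star (c • a * g) * (c • a * g) = ((‖c‖ ^ 2 : ℝ) : ℂ) • (star (a * g) * (a * g)) := by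
    rw [smul_mul_assoc, star_smul, smul_mul_smul_comm, RCLike.star_def, Complex.conj_mul']
    norm_cast
  rw [this, map_smul, Complex.coe_smul, mul_pow, mul_smul]
  exact smul_le_smul_of_nonneg_left (hs.2 g) (by positivity)

end Smul

variable (hE : ∀ f, 0 ≤ E (star f * f))
include hE

theorem mem_bounds_of_le {a : R} {s t : ℝ} (hs : s ∈ bounds E a) (hst : s ≤ t) :
    t ∈ bounds E a := by
  refine ⟨hs.1.trans hst, fun g => (hs.2 g).trans ?_⟩
  exact smul_le_smul_of_nonneg_right (pow_le_pow_left₀ hs.1 hst 2) (hE g)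

variable [StarModule ℂ R]

/-- Positivity of E at t·ag - s·bg is a weighted parallelogram inequality that replaces
Cauchy–Schwarz for the A-valued form. Strict positivity of s and t allows the final division by ts.
-/
theorem add_mem_bounds {a b : R} {s t : ℝ} (hs : s ∈ bounds E a) (ht : t ∈ bounds E b)
    (hs0 : 0 < s) (ht0 : 0 < t) : s + t ∈ bounds E (a + b) := by
  refine ⟨by positivity, fun g => ?_⟩
  have h1 := hE ((t : ℂ) • (a * g) - (s : ℂ) • (b * g))
  have e1 : star ((t : ℂ) • (a * g) - (s : ℂ) • (b * g)) *
      ((t : ℂ) • (a * g) - (s : ℂ) • (b * g)) =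
      (((t + s) * t : ℝ) : ℂ) • (star (a * g) * (a * g)) +
      (((t + s) * s : ℝ) : ℂ) • (star (b * g) * (b * g)) -
      ((t * s : ℝ) : ℂ) • (star ((a + b) * g) * ((a + b) * g)) := by
    simp only [add_mul, star_sub, star_add, star_smul, RCLike.star_def, Complex.conj_ofReal]
    generalize a * g = x
    generalize b * g = y
    simp only [sub_mul, mul_sub, mul_add, smul_mul_smul_comm]
    push_cast
    module
  have h2 : (t * s) • E (star ((a + b) * g) * ((a + b) * g)) ≤
      ((t + s) * t) • E (star (a * g) * (a * g)) + ((t + s) * s) • E (star (b * g) * (b * g)) := by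
    rw [e1, map_sub, map_add, map_smul, map_smul, map_smul, sub_nonneg] at h1
    simpa only [Complex.coe_smul] using h1
  have h3 : (t * s) • E (star ((a + b) * g) * ((a + b) * g)) ≤
      (t * s) • ((s + t) ^ 2 • E (star g * g)) := by
    refine h2.trans ((add_le_add (smul_le_smul_of_nonneg_left (hs.2 g) (by positivity))
      (smul_le_smul_of_nonneg_left (ht.2 g) (by positivity))).trans_eq ?_)
    module
  exact (smul_le_smul_iff_of_pos_left (by positivity)).mp h3

/-- Expanding E at s·g - a*ag gives 2s·E(|ag|²) ≤ s²E(|g|²) + E(|a*ag|²) ≤ 2s²E(|g|²). This is the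
nontrivial half of the `C*`-identity. -/
theorem sqrt_mem_bounds {a : R} {s : ℝ} (hs : s ∈ bounds E (star a * a)) (hs0 : 0 < s) :
    √s ∈ bounds E a := by
  refine ⟨Real.sqrt_nonneg _, fun g => ?_⟩
  rw [Real.sq_sqrt hs0.le]
  have h1 := hE ((s : ℂ) • g - (star a * a) * g)
  have e1 : star ((s : ℂ) • g - (star a * a) * g) * ((s : ℂ) • g - (star a * a) * g) =
      ((s ^ 2 : ℝ) : ℂ) • (star g * g) + star (star a * a * g) * (star a * a * g) -
      ((2 * s : ℝ) : ℂ) • (star (a * g) * (a * g)) := by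
    simp only [star_sub, star_mul, star_star, star_smul, RCLike.star_def, Complex.conj_ofReal,
      sub_mul, mul_sub, smul_mul_assoc, mul_smul_comm, mul_assoc]
    push_cast
    module
  rw [e1, map_sub, map_add, map_smul, map_smul, sub_nonneg] at h1
  simp only [Complex.coe_smul] at h1
  have h2 : (2 * s) • E (star (a * g) * (a * g)) ≤ (2 * s) • (s • E (star g * g)) := by
    refine h1.trans ((add_le_add le_rfl (hs.2 g)).trans_eq ?_)
    module
  exact (smul_le_smul_iff_of_pos_left (by positivity)).mp h2

variable [CompleteSpace R] [NormedStarGroup R]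

/-- Writing 1 - t⁻²a*a = w² with w self-adjoint gives E(|g|²) - t⁻²E(|ag|²) = E(|wg|²) ≥ 0. In
particular the set of bounds is nonempty, so its infimum is not the default value 0. -/
theorem mem_bounds_of_norm_lt {a : R} {t : ℝ} (ht : ‖a‖ < t) : t ∈ bounds E a := by
  have ht0 : 0 < t := (norm_nonneg a).trans_lt ht
  have h1 : specRadius ((((t ^ 2)⁻¹ : ℝ) : ℂ) • (star a * a)) < 1 := by
    refine (specRadius_le_norm _).trans_lt ?_
    rw [norm_smul, Complex.norm_real, norm_inv, Real.norm_of_nonneg (by positivity),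
      inv_mul_lt_iff₀ (by positivity), mul_one]
    refine (norm_mul_le _ _).trans_lt ?_
    rw [norm_star, ← sq]
    exact pow_lt_pow_left₀ ht (norm_nonneg _) two_ne_zero
  obtain ⟨w, hw, hw2⟩ := exists_isSelfAdjoint_mul_self_eq
    (IsSelfAdjoint.smul (by simp [IsSelfAdjoint]) (IsSelfAdjoint.star_mul_self a)) h1
  refine ⟨ht0.le, fun g => ?_⟩
  have h2 := hE (w * g)
  have e2 : star (w * g) * (w * g) =
      star g * g - (((t ^ 2)⁻¹ : ℝ) : ℂ) • (star (a * g) * (a * g)) := by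
    rw [star_mul, hw.star_eq, mul_assoc, ← mul_assoc w, hw2]
    simp only [star_mul, sub_mul, mul_sub, one_mul, smul_mul_assoc, mul_smul_comm, mul_assoc]
  rw [e2, map_sub, map_smul, sub_nonneg, Complex.coe_smul] at h2
  rwa [inv_smul_le_iff_of_pos (by positivity)] at h2

theorem opSeminorm_mem (a : R) : opSeminorm E a ∈ bounds E a :=
  (isClosed_bounds a).csInf_mem ⟨‖a‖ + 1, mem_bounds_of_norm_lt hE (by linarith)⟩
    (bddBelow_bounds a)

/-- The slack ε supplies the strict positivity that `add_mem_bounds` and `sqrt_mem_bounds` require.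
-/
theorem add_pos_mem {a : R} {ε : ℝ} (hε : 0 < ε) : opSeminorm E a + ε ∈ bounds E a :=
  mem_bounds_of_le hE (opSeminorm_mem hE a) (by linarith)

/-- The least bound of left multiplication, as a seminorm. -/
noncomputable def seminorm : Seminorm ℂ R :=
  Seminorm.ofSMulLE (opSeminorm E)
    (le_antisymm (opSeminorm_le zero_mem_bounds) (opSeminorm_nonneg 0))
    (fun a b => by
      refine le_of_forall_pos_le_add fun ε hε => ?_
      have h := add_mem_bounds hE (add_pos_mem hE (a := a) (half_pos hε))
        (add_pos_mem hE (a := b) (half_pos hε))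
        (add_pos_of_nonneg_of_pos (opSeminorm_nonneg a) (half_pos hε))
        (add_pos_of_nonneg_of_pos (opSeminorm_nonneg b) (half_pos hε))
      linarith [opSeminorm_le h])
    (fun c a => opSeminorm_le (smul_mem_bounds (opSeminorm_mem hE a) c))

theorem isCStarSeminorm_seminorm : IsCStarSeminorm (seminorm hE) := by
  have hmul (a b : R) : opSeminorm E (a * b) ≤ opSeminorm E a * opSeminorm E b :=
    opSeminorm_le (mul_mem_bounds (opSeminorm_mem hE a) (opSeminorm_mem hE b))
  have hsq (a : R) : opSeminorm E a ^ 2 ≤ opSeminorm E (star a * a) := by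
    refine le_of_forall_pos_le_add fun ε hε => ?_
    have h0 : 0 < opSeminorm E (star a * a) + ε :=
      add_pos_of_nonneg_of_pos (opSeminorm_nonneg _) hε
    have h := opSeminorm_le (sqrt_mem_bounds hE (add_pos_mem hE hε) h0)
    exact (Real.le_sqrt (opSeminorm_nonneg _) h0.le).mp h
  have hstar (a : R) : opSeminorm E (star a) ≤ opSeminorm E a := by
    have h := (hsq (star a)).trans (hmul _ _)
    rw [star_star, sq] at h
    rcases (opSeminorm_nonneg (E := E) (star a)).eq_or_lt with h0 | h0
    · rw [← h0]; exact opSeminorm_nonneg _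
    · exact le_of_mul_le_mul_right h h0
  refine ⟨hmul, fun a => le_antisymm ?_ (hsq a), fun a => ?_⟩
  · refine (hmul _ _).trans ?_
    rw [sq]
    exact mul_le_mul_of_nonneg_right (hstar a) (opSeminorm_nonneg _)
  · exact le_of_forall_pos_le_add fun ε hε => opSeminorm_le (mem_bounds_of_norm_lt hE (by linarith))

/-- Testing the bound at g = 1 compares E(a*a) with the seminorm of E, one of those whose supremum
is the universal one. -/
theorem norm_le_universalSeminorm_sq (h1 : E 1 = 1) (a : R) :
    ‖E (star a * a)‖ ≤ universalSeminorm R a ^ 2 := by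
  have h2 : E (star a * a) ≤ opSeminorm E a ^ 2 • (1 : A) := by
    simpa [h1] using (opSeminorm_mem hE a).2 1
  have h3 : ‖E (star a * a)‖ ≤ opSeminorm E a ^ 2 := by
    rw [← Algebra.algebraMap_eq_smul_one] at h2
    exact (CStarAlgebra.norm_le_iff_le_algebraMap _ (sq_nonneg _) (hE a)).mpr h2
  refine h3.trans (pow_le_pow_left₀ (opSeminorm_nonneg _) ?_ 2)
  exact le_universal ⟨seminorm hE, isCStarSeminorm_seminorm hE⟩ a

end PositiveMap

/-! ### Delta functions -/

namespace L1

variable {G : Type u} {B : Type v} [Group G] [NormedAddCommGroup B] [NormedSpace ℂ B]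
variable {F : FibreOps G B}

open Classical in
omit [Group G] [NormedSpace ℂ B] in
theorem summable_norm_ite (x : G) (b : B) : Summable fun y => ‖if y = x then b else 0‖ :=
  summable_of_ne_finset_zero (s := {x}) fun y hy => by
    rw [if_neg (by simpa using hy), norm_zero]

variable (F) in
open Classical in
/-- The element of `ℓ¹(G; B)` that takes the value `b` at `x` and vanishes elsewhere, as a
continuous linear function of `b`. -/
noncomputable def single (x : G) : B →L[ℂ] L1 F :=
  LinearMap.mkContinuous
    { toFun := fun b => mk (fun y => if y = x then b else 0) (summable_norm_ite x b)
      map_add' := fun b c => ext fun y => by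
        simp only [add_apply, mk_apply]; split_ifs <;> simp
      map_smul' := fun c b => ext fun y => by
        simp only [smul_apply, mk_apply, RingHom.id_apply]; split_ifs <;> simp }
    1 fun b => by
      rw [norm_eq, tsum_eq_single x, one_mul]
      · simp [mk_apply]
      · intro y hy; simp [mk_apply, hy]

theorem single_apply_self (x : G) (b : B) : single F x b x = b := if_pos rfl

theorem single_apply_of_ne {x y : G} (h : y ≠ x) (b : B) : single F x b y = 0 := if_neg h

theorem norm_single_le (x : G) (b : B) : ‖single F x b‖ ≤ ‖b‖ := by
  rw [norm_eq, tsum_eq_single x, single_apply_self]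
  intro y hy
  rw [single_apply_of_ne hy, norm_zero]

theorem single_mul_single (x y : G) (a b : B) :
    single F x a * single F y b = single F (x * y) (F.mul x y a b) := by
  refine ext fun z => ?_
  rw [mul_apply, tsum_eq_single x, single_apply_self]
  · by_cases h : z = x * y
    · subst h
      rw [inv_mul_cancel_left, single_apply_self, single_apply_self]
    · rw [single_apply_of_ne h, single_apply_of_ne (fun h' => h (by rw [← h', mul_inv_cancel_left])),
        map_zero]
  · intro w hw
    rw [single_apply_of_ne hw, map_zero, LinearMap.zero_apply]

theorem star_single (x : G) (a : B) : star (single F x a) = single F x⁻¹ (F.inv x a) := by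
  refine ext fun z => ?_
  rw [star_apply]
  by_cases h : z = x⁻¹
  · subst h
    rw [single_apply_self, inv_inv, single_apply_self]
  · rw [single_apply_of_ne h, single_apply_of_ne (fun h' => h (by rw [← h', inv_inv])), map_zero]

end L1

/-! ### The untwisted algebra with unital values -/

namespace plainOps

variable {G : Type u} {D : Type v} [Group G] [CStarAlgebra D]

noncomputable instance : One (L1 (plainOps G D)) := ⟨L1.single _ 1 1⟩

theorem one_def : (1 : L1 (plainOps G D)) = L1.single _ 1 1 := rfl

noncomputable instance : NormedRing (L1 (plainOps G D)) where
  __ : NonUnitalNormedRing (L1 (plainOps G D)) := inferInstance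
  one_mul f := L1.ext fun x => by
    rw [plain_mul_apply, tsum_eq_single 1]
    · rw [one_def, L1.single_apply_self, inv_one, one_mul, one_mul]
    · intro y hy; rw [one_def, L1.single_apply_of_ne hy, zero_mul]
  mul_one f := L1.ext fun x => by
    rw [plain_mul_apply, tsum_eq_single x]
    · rw [one_def, inv_mul_cancel, L1.single_apply_self, mul_one]
    · intro y hy
      rw [one_def, L1.single_apply_of_ne (fun h => hy (inv_mul_eq_one.mp h)), mul_zero]

noncomputable instance : NormedAlgebra ℂ (L1 (plainOps G D)) where
  __ := Algebra.ofModule (R := ℂ) (A := L1 (plainOps G D)) smul_mul_assoc mul_smul_comm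
  norm_smul_le := norm_smul_le

end plainOps

/-! ### Spectral permanence for elements with real spectrum -/

section Permanence

/-- The parts of the complement in the two closed half-planes are connected and share a real point,
as a bounded set misses some real number. -/
theorem isConnected_compl_of_forall_im_eq_zero {s : Set ℂ} (hb : Bornology.IsBounded s)
    (h : ∀ z ∈ s, z.im = 0) : IsConnected sᶜ := by
  suffices IsConnected (sᶜ ∩ {z | 0 ≤ z.im} ∪ sᶜ ∩ {z | z.im ≤ 0}) by
    rw [← Set.inter_union_distrib_left] at this
    rw [← Set.inter_univ sᶜ]
    convert this
    exact Eq.symm <| Set.eq_univ_of_forall fun z => le_total 0 z.im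
  refine IsConnected.union ?nonempty ?upper ?lower
  case nonempty =>
    have := Filter.NeBot.nonempty_of_mem inferInstance <| Filter.mem_map.mp <|
      Complex.isometry_ofReal.antilipschitz.tendsto_cobounded hb.compl
    exact this.image Complex.ofReal |>.mono <| by simp
  case' upper => apply Complex.isConnected_of_upperHalfPlane ?_ <| Set.inter_subset_right
  case' lower => apply Complex.isConnected_of_lowerHalfPlane ?_ <| Set.inter_subset_right
  all_goals
    refine Set.subset_inter (fun z hz hz' => ?_) (fun _ => by simpa using le_of_lt)
    rw [Set.mem_ofPred_eq, h z hz'] at hz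
    simp_all

/-- The range of Φ is a closed subalgebra; relative to it the spectrum could grow only by filling
holes, and a bounded real set has none. -/
theorem spectrum_eq_of_isometry {R : Type v} {M : Type w} [NormedRing R] [NormedAlgebra ℂ R]
    [CompleteSpace R] [NormedRing M] [NormedAlgebra ℂ M] [CompleteSpace M] (Φ : R →ₐ[ℂ] M)
    (hΦ : Isometry Φ) {h : R} (hr : ∀ z ∈ spectrum ℂ (Φ h), z.im = 0) :
    spectrum ℂ h = spectrum ℂ (Φ h) := by
  have : IsClosed (Φ.range : Set M) := by
    rw [AlgHom.coe_range]
    exact hΦ.isClosedEmbedding.isClosed_range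
  have h1 := AlgEquiv.spectrum_eq (AlgEquiv.ofInjective Φ hΦ.injective) h
  have h2 := Subalgebra.spectrum_eq_of_isPreconnected_compl Φ.range
    (AlgEquiv.ofInjective Φ hΦ.injective h)
    (isConnected_compl_of_forall_im_eq_zero (spectrum.isBounded _) hr).isPreconnected
  rw [← h1, h2]
  rfl

end Permanence

/-! ### The twisted `ℓ¹`-algebra of a rigidly symmetric group is hermitian -/

namespace TwistedSystem

variable {G : Type u} {A : Type v} [Group G] [CStarAlgebra A] (S : TwistedSystem G A)

/-- Evaluation at the unit of the group. -/
noncomputable def evalOne : L1 S.ops →ₗ[ℂ] A where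
  toFun f := f 1
  map_add' _ _ := rfl
  map_smul' _ _ := rfl

/-- The factor ω(y, y⁻¹)* from the involution and the factor ω(y, y⁻¹) from the product combine into
a sum of squares, whence positivity. -/
theorem evalOne_star_mul_self (f : L1 S.ops) :
    S.evalOne (star f * f) = ∑' y, star (S.α y (f y⁻¹) * (S.ω y y⁻¹ : A)) *
      (S.α y (f y⁻¹) * (S.ω y y⁻¹ : A)) := by
  change (star f * f) 1 = _
  rw [S.mul_apply]
  refine tsum_congr fun y => ?_
  rw [S.star_apply, mul_one, star_mul]
  simp only [mul_assoc]

theorem evalOne_nonneg [PartialOrder A] [StarOrderedRing A] (f : L1 S.ops) :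
    0 ≤ S.evalOne (star f * f) := by
  rw [evalOne_star_mul_self]
  exact tsum_nonneg fun y => star_mul_self_nonneg _

theorem evalOne_one : S.evalOne 1 = 1 := by
  change (1 : L1 S.ops) 1 = 1
  rw [S.one_apply, if_pos rfl]

theorem norm_evalOne_single (x : G) (a : A) :
    ‖S.evalOne (star (L1.single S.ops x a) * L1.single S.ops x a)‖ = ‖a‖ ^ 2 := by
  rw [evalOne_star_mul_self, tsum_eq_single x⁻¹]
  · rw [inv_inv, L1.single_apply_self, CStarRing.norm_star_mul_self,
      CStarRing.norm_mul_coe_unitary, S.norm_α, sq]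
  · intro y hy
    rw [L1.single_apply_of_ne (fun h => hy (by rw [← h, inv_inv])), map_zero, zero_mul, mul_zero]

/-- The image in the crossed product of the delta functions at `x`. -/
noncomputable def fibre (x : G) : A →L[ℂ] S.CrossedProduct :=
  LinearMap.mkContinuous
    ((Enveloping.ι (L1 S.ops)).toAlgHom.toLinearMap ∘ₗ (L1.single S.ops x).toLinearMap) 1
    fun a => by
      rw [one_mul]
      exact ((Enveloping.norm_of _).trans_le ((isCStarSeminorm_universal _).le_norm _)).trans
        (L1.norm_single_le x a)

theorem fibre_apply (x : G) (a : A) :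
    S.fibre x a = Enveloping.ι (L1 S.ops) (L1.single S.ops x a) := rfl

/-- Contractivity is automatic; the lower bound comes from evaluation at 1, which maps (aδ_x)*(aδ_x)
to an element of norm ‖a‖². -/
theorem norm_fibre (x : G) (a : A) : ‖S.fibre x a‖ = ‖a‖ := by
  let : PartialOrder A := CStarAlgebra.spectralOrder A
  have : StarOrderedRing A := CStarAlgebra.spectralOrderedRing A
  have hn : ‖S.fibre x a‖ = universalSeminorm (L1 S.ops) (L1.single S.ops x a) :=
    Enveloping.norm_of _
  rw [hn]
  refine le_antisymm (((isCStarSeminorm_universal _).le_norm _).trans (L1.norm_single_le x a)) ?_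
  have h := PositiveMap.norm_le_universalSeminorm_sq (E := S.evalOne) S.evalOne_nonneg
    S.evalOne_one (L1.single S.ops x a)
  rw [norm_evalOne_single] at h
  exact le_of_sq_le_sq h (apply_nonneg _ _)

theorem summable_norm_fibre (f : L1 S.ops) : Summable fun x => ‖S.fibre x (f x)‖ := by
  simpa only [norm_fibre] using f.summable_norm

/-- The embedding of the twisted `ℓ¹`-algebra into the untwisted `ℓ¹`-algebra with values in the
crossed product. -/
noncomputable def untwist : L1 S.ops →ₐ[ℂ] L1 (plainOps G S.CrossedProduct) :=
  AlgHom.ofLinearMap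
    { toFun := fun f => L1.mk (fun x => S.fibre x (f x)) (S.summable_norm_fibre f)
      map_add' := fun f g => L1.ext fun x => map_add (S.fibre x) (f x) (g x)
      map_smul' := fun c f => L1.ext fun x => map_smul (S.fibre x) c (f x) }
    (L1.ext fun x => by
      simp only [LinearMap.coe_mk, AddHom.coe_mk, L1.mk_apply]
      rw [S.one_apply, plainOps.one_def]
      by_cases h : x = 1
      · subst h
        rw [if_pos rfl, L1.single_apply_self, fibre_apply]
        exact map_one (Enveloping.ι (L1 S.ops))
      · rw [if_neg h, L1.single_apply_of_ne h, map_zero])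
    (fun f g => L1.ext fun x => by
      simp only [LinearMap.coe_mk, AddHom.coe_mk, L1.mk_apply]
      rw [L1.mul_apply, plain_mul_apply, ContinuousLinearMap.map_tsum _ (L1.summable_term f g x)]
      refine tsum_congr fun y => ?_
      -- The twisted rule for aδ_y · bδ_z is the product of the two values in the crossed product,
      -- so plain convolution absorbs α and ω.
      simp only [L1.mk_apply, fibre_apply]
      rw [← map_mul, L1.single_mul_single, mul_inv_cancel_left])

theorem untwist_apply (f : L1 S.ops) (x : G) : S.untwist f x = S.fibre x (f x) := rfl

theorem untwist_star (f : L1 S.ops) : S.untwist (star f) = star (S.untwist f) :=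
  L1.ext fun x => by
    rw [plain_star_apply, untwist_apply, untwist_apply, fibre_apply, fibre_apply, ← map_star,
      L1.star_single, L1.star_apply, _root_.inv_inv]

theorem isometry_untwist : Isometry S.untwist :=
  AddMonoidHomClass.isometry_of_norm _ fun f => by
    rw [L1.norm_eq, L1.norm_eq]
    simp only [untwist_apply, norm_fibre]

/-- Rigid symmetry is applied with the crossed product as coefficient algebra. For z in the spectrum
of the self-adjoint image of h, z² ≥ 0 forces z to be real, and permanence carries this back. -/
theorem isHermitianAlgebra_l1 (hG : IsRigidlySymmetric.{u, max u v} G) :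
    IsHermitianAlgebra (L1 S.ops) := by
  intro h hh
  have hr : ∀ z ∈ spectrum ℂ (S.untwist h), z.im = 0 := by
    intro z hz
    have h1 : z ^ 2 ∈ spectrum ℂ (star (S.untwist h) * S.untwist h) := by
      rw [← S.untwist_star, hh.star_eq, ← sq]
      exact spectrum.pow_image_subset _ 2 ⟨z, hz, rfl⟩
    have h2 := hG S.CrossedProduct (S.untwist h) (z ^ 2)
      (spectrum_subset_quasispectrum ℂ _ h1)
    rw [sq, Complex.mul_re, Complex.mul_im] at h2
    have h3 : z.re * z.im = 0 := by linarith [h2.2]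
    rcases mul_eq_zero.mp h3 with h4 | h4
    · rw [h4] at h2
      nlinarith [h2.1]
    · exact h4
  rw [spectrum_eq_of_isometry S.untwist S.isometry_untwist hr]
  exact hr

end TwistedSystem

/-! ### Quotients of Banach `*`-algebras -/

/-- A closed two-sided ideal that is invariant under the involution. -/
class IsClosedStarIdeal {R : Type w} [NormedRing R] [StarRing R] (I : Ideal R) : Prop
    extends I.IsTwoSided where
  isClosed : IsClosed (I : Set R)
  star_mem : ∀ a ∈ I, star a ∈ I

namespace IsClosedStarIdeal

variable {R : Type w} [NormedRing R] [NormedAlgebra ℂ R] [StarRing R]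
variable (I : Ideal R) [IsClosedStarIdeal I]

instance : IsClosed (I : Set R) := isClosed

omit [NormedAlgebra ℂ R] in
theorem norm_mk_le (a : R) : ‖Ideal.Quotient.mk I a‖ ≤ ‖a‖ := Submodule.Quotient.norm_mk_le I a

omit [NormedAlgebra ℂ R] in
theorem exists_norm_lt (x : R ⧸ I) {ε : ℝ} (hε : 0 < ε) :
    ∃ a : R, Ideal.Quotient.mk I a = x ∧ ‖a‖ < ‖x‖ + ε :=
  Submodule.Quotient.norm_mk_lt x hε

noncomputable instance : NormedRing (R ⧸ I) where
  __ := (inferInstance : Ring (R ⧸ I))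
  __ := (inferInstance : NormedAddCommGroup (R ⧸ I))
  norm_mul_le x y := by
    have key : ∀ ε > 0, ‖x * y‖ ≤ (‖x‖ + ε) * (‖y‖ + ε) := fun ε hε => by
      obtain ⟨a, rfl, ha⟩ := exists_norm_lt I x hε
      obtain ⟨b, rfl, hb⟩ := exists_norm_lt I y hε
      rw [← map_mul]
      exact (norm_mk_le I _).trans ((norm_mul_le a b).trans
        (mul_le_mul ha.le hb.le (norm_nonneg _) ((norm_nonneg _).trans ha.le)))
    have ht : Filter.Tendsto (fun ε : ℝ => (‖x‖ + ε) * (‖y‖ + ε)) (nhdsWithin 0 (Set.Ioi 0))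
        (nhds ((‖x‖ + 0) * (‖y‖ + 0))) :=
      (Continuous.tendsto (by fun_prop) 0).mono_left nhdsWithin_le_nhds
    rw [add_zero, add_zero] at ht
    exact ge_of_tendsto ht (eventually_nhdsWithin_of_forall key)

noncomputable instance : NormedAlgebra ℂ (R ⧸ I) where
  __ := (inferInstance : Algebra ℂ (R ⧸ I))
  norm_smul_le c x := norm_smul_le c x

instance [CompleteSpace R] : CompleteSpace (R ⧸ I) :=
  Submodule.Quotient.completeSpace I

instance : Star (R ⧸ I) :=
  ⟨Quotient.map' star fun a b h => by
    rw [Submodule.quotientRel_def] at h ⊢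
    rw [← star_sub]
    exact star_mem _ h⟩

omit [NormedAlgebra ℂ R] in
theorem mk_star (a : R) : Ideal.Quotient.mk I (star a) = star (Ideal.Quotient.mk I a) := rfl

instance : StarRing (R ⧸ I) where
  star_involutive x := by
    obtain ⟨a, rfl⟩ := Ideal.Quotient.mk_surjective x
    rw [← mk_star, ← mk_star, star_star]
  star_mul x y := by
    obtain ⟨a, rfl⟩ := Ideal.Quotient.mk_surjective x
    obtain ⟨b, rfl⟩ := Ideal.Quotient.mk_surjective y
    rw [← map_mul, ← mk_star, ← mk_star, ← mk_star, star_mul, map_mul]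
  star_add x y := by
    obtain ⟨a, rfl⟩ := Ideal.Quotient.mk_surjective x
    obtain ⟨b, rfl⟩ := Ideal.Quotient.mk_surjective y
    rw [← map_add, ← mk_star, ← mk_star, ← mk_star, star_add, map_add]

theorem mk_smul (c : ℂ) (a : R) : Ideal.Quotient.mk I (c • a) = c • Ideal.Quotient.mk I a := rfl

instance [StarModule ℂ R] : StarModule ℂ (R ⧸ I) where
  star_smul c x := by
    obtain ⟨a, rfl⟩ := Ideal.Quotient.mk_surjective x
    rw [← mk_smul, ← mk_star, ← mk_star, star_smul, mk_smul]

instance [NormedStarGroup R] : NormedStarGroup (R ⧸ I) where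
  norm_star_le x := by
    refine le_of_forall_pos_le_add fun ε hε => ?_
    obtain ⟨a, rfl, ha⟩ := exists_norm_lt I x hε
    rw [← mk_star]
    exact (norm_mk_le I _).trans (by rw [norm_star]; exact ha.le)

theorem isCStarSeminorm_comp_mk {p : Seminorm ℂ (R ⧸ I)} (hp : IsCStarSeminorm p) :
    IsCStarSeminorm (p.comp (Ideal.Quotient.mkₐ ℂ I).toLinearMap) where
  mul_le a b := by
    have := hp.mul_le (Ideal.Quotient.mk I a) (Ideal.Quotient.mk I b)
    rwa [← map_mul] at this
  star_mul_self a := by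
    have := hp.star_mul_self (Ideal.Quotient.mk I a)
    rwa [← mk_star, ← map_mul] at this
  le_norm a := (hp.le_norm _).trans (norm_mk_le I a)

variable [StarModule ℂ R]

/-- A self-adjoint class lifts to the self-adjoint element (a + a*)/2, and quotient maps shrink
spectra. -/
theorem isHermitianAlgebra_quotient (H : IsHermitianAlgebra R) : IsHermitianAlgebra (R ⧸ I) := by
  intro x hx z hz
  obtain ⟨a, rfl⟩ := Ideal.Quotient.mk_surjective x
  have hb : IsSelfAdjoint ((1 / 2 : ℂ) • (a + star a)) :=
    IsSelfAdjoint.smul (by simp [IsSelfAdjoint]) (IsSelfAdjoint.add_star_self a)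
  refine H _ hb z (AlgHom.spectrum_apply_subset (Ideal.Quotient.mkₐ ℂ I) _ ?_)
  have : Ideal.Quotient.mkₐ ℂ I ((1 / 2 : ℂ) • (a + star a)) = Ideal.Quotient.mk I a := by
    change Ideal.Quotient.mk I _ = _
    rw [mk_smul, map_add, mk_star, hx.star_eq, ← two_smul ℂ, smul_smul]
    norm_num
  rwa [this]

variable [CompleteSpace R] [NormedStarGroup R]

/-- The Pták function of the quotient pulls back to a `C*`-seminorm on R, so the universal seminorm
of a bounds the spectral radius of its class. -/
theorem isUnit_one_sub_mk (H : IsHermitianAlgebra R) {a : R} (ha : universalSeminorm R a < 1) :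
    IsUnit (1 - Ideal.Quotient.mk I a) := by
  have HQ := isHermitianAlgebra_quotient I H
  refine isUnit_one_sub_of_specRadius_lt ((HQ.specRadius_le_ptak _).trans_lt ?_)
  exact (le_universal ⟨_, isCStarSeminorm_comp_mk I HQ.isCStarSeminorm_ptak⟩ a).trans_lt ha

/-- Replace c by a nearby image of some j ∈ I. Then 1 + j - ab has universal seminorm below 1, and
modulo I, 1 minus it is ab. -/
theorem isUnit_mk_mul_mk (H : IsHermitianAlgebra R) {a b : R} {c : Enveloping R}
    (h : c ∈ closure (Enveloping.ι R '' (I : Set R)))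
    (hab : ‖Enveloping.ι R (a * b) - 1 - c‖ < 1) :
    IsUnit (Ideal.Quotient.mk I a * Ideal.Quotient.mk I b) := by
  obtain ⟨_, ⟨j, hj, rfl⟩, hjc⟩ := Metric.mem_closure_iff.mp h _ (sub_pos.mpr hab)
  have h1 : universalSeminorm R (1 + j - a * b) < 1 := by
    rw [← Enveloping.norm_of]
    change ‖Enveloping.ι R (1 + j - a * b)‖ < 1
    have e : Enveloping.ι R (1 + j - a * b) =
        -((Enveloping.ι R (a * b) - 1 - c) + (c - Enveloping.ι R j)) := by
      rw [map_sub, map_add, map_one]; abel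
    rw [e, norm_neg]
    rw [dist_eq_norm] at hjc
    exact (norm_add_le _ _).trans_lt (by linarith)
  have h2 := isUnit_one_sub_mk I H h1
  rw [map_sub, map_add, map_one, map_mul, Ideal.Quotient.eq_zero_iff_mem.mpr hj] at h2
  simpa using h2

/-- In a hermitian Banach `*`-algebra, invertibility modulo a closed `*`-ideal is detected in the
enveloping `C*`-algebra. -/
theorem isUnit_mk (H : IsHermitianAlgebra R) {f : R} {g : Enveloping R}
    (h1 : Enveloping.ι R f * g - 1 ∈ closure (Enveloping.ι R '' (I : Set R)))
    (h2 : g * Enveloping.ι R f - 1 ∈ closure (Enveloping.ι R '' (I : Set R))) :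
    IsUnit (Ideal.Quotient.mk I f) := by
  -- This radius makes ‖f‖·‖h - g‖ < 1; the added 1 covers the case where the image of f is 0.
  have hδ : 0 < (‖Enveloping.ι R f‖ + 1)⁻¹ := by positivity
  obtain ⟨h, hh⟩ := Metric.denseRange_iff.mp (Enveloping.denseRange_of (B := R)) g _ hδ
  change dist g (Enveloping.ι R h) < _ at hh
  rw [dist_eq_norm, norm_sub_rev] at hh
  have hlt : ‖Enveloping.ι R f‖ * ‖Enveloping.ι R h - g‖ < 1 := by
    have hn := norm_nonneg (Enveloping.ι R f)
    rw [← one_div, lt_div_iff₀ (by positivity)] at hh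
    nlinarith [norm_nonneg (Enveloping.ι R h - g)]
  have hl : IsUnit (Ideal.Quotient.mk I f * Ideal.Quotient.mk I h) :=
    isUnit_mk_mul_mk I H h1 (by
      rw [sub_sub_sub_cancel_right, map_mul, ← mul_sub]
      exact (norm_mul_le _ _).trans_lt hlt)
  have hr : IsUnit (Ideal.Quotient.mk I h * Ideal.Quotient.mk I f) :=
    isUnit_mk_mul_mk I H h2 (by
      rw [sub_sub_sub_cancel_right, map_mul, ← sub_mul]
      exact (norm_mul_le _ _).trans_lt (by rwa [mul_comm]))
  obtain ⟨x, hx⟩ := hl.exists_right_inv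
  obtain ⟨y, hy⟩ := hr.exists_left_inv
  exact isUnit_iff_exists_and_exists.mpr ⟨⟨_, (mul_assoc _ _ _).symm.trans hx⟩,
    ⟨_, (mul_assoc _ _ _).trans hy⟩⟩

end IsClosedStarIdeal

/-! ### Invariant ideals and the main theorem -/

namespace TwistedSystem

variable {G : Type u} {A : Type v} [Group G] [CStarAlgebra A] {S : TwistedSystem G A}
variable (J : S.InvariantIdeal)

theorem InvariantIdeal.isClosed_l1Ideal : IsClosed (J.l1Ideal : Set (L1 S.ops)) := by
  have : (J.l1Ideal : Set (L1 S.ops)) = ⋂ x, {f : L1 S.ops | f x ∈ J.ideal} := by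
    ext f
    rw [Set.mem_iInter]
    rfl
  rw [this]
  refine isClosed_iInter fun x => J.isClosed.preimage (f := fun f : L1 S.ops => f x) ?_
  exact (LipschitzWith.of_dist_le_mul (K := 1) fun f g => by
    rw [dist_eq_norm, dist_eq_norm, NNReal.coe_one, one_mul]
    exact L1.norm_apply_le (f - g) x).continuous

instance : IsClosedStarIdeal J.l1Ideal where
  mul_mem_of_left b ha := Ideal.mul_mem_right b _ ha
  isClosed := J.isClosed_l1Ideal
  star_mem f hf x := by
    rw [S.star_apply]
    exact J.ideal.mul_mem_left _ (J.star_mem _ (J.α_mem _ _ (hf _)))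

theorem isInverseClosedMod_l1Subalgebra (hG : IsRigidlySymmetric.{u, max u v} G) :
    IsInverseClosedMod S.l1Subalgebra.toSubalgebra J.crossedIdeal := by
  rintro _ ⟨f, rfl⟩ g h1 h2
  obtain ⟨⟨x, y, hxy, hyx⟩, hx : x = _⟩ :=
    IsClosedStarIdeal.isUnit_mk J.l1Ideal (S.isHermitianAlgebra_l1 hG) h1 h2
  subst hx
  obtain ⟨k, rfl⟩ := Ideal.Quotient.mk_surjective y
  refine ⟨Enveloping.ι _ k, ⟨k, rfl⟩, ?_⟩
  have h3 : Enveloping.ι (L1 S.ops) (k * f - 1) ∈ J.crossedIdeal := by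
    refine subset_closure ⟨_, ?_, rfl⟩
    change k * f - 1 ∈ J.l1Ideal
    rw [← Ideal.Quotient.eq_zero_iff_mem, map_sub, map_mul, hyx, map_one, sub_self]
  -- Comparing two inverses of f: k - g = (kf - 1)g - k(fg - 1), with both terms in the two-sided
  -- ideal.
  have e : Enveloping.ι (L1 S.ops) k - g =
      Enveloping.ι (L1 S.ops) (k * f - 1) * g -
      Enveloping.ι (L1 S.ops) k * (Enveloping.ι (L1 S.ops) f * g - 1) := by
    rw [map_sub, map_mul, map_one]; noncomm_ring
  rw [e]
  exact J.crossedIdeal.sub_mem (J.crossedIdeal.mul_mem_right _ h3)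
    (J.crossedIdeal.mul_mem_left _ h1)

end TwistedSystem

theorem IsInverseClosedMod.isInverseClosed_map {C : Type w} [Ring C] [Algebra ℂ C]
    {D : Subalgebra ℂ C} {I : Ideal C} [I.IsTwoSided] (h : IsInverseClosedMod D I) :
    IsInverseClosed (D.map (Ideal.Quotient.mkₐ ℂ I)) := by
  rintro ⟨c, d, hcd, hdc⟩ ⟨f, hf, hfc : Ideal.Quotient.mk I f = c⟩
  subst hfc
  obtain ⟨g, rfl⟩ := Ideal.Quotient.mk_surjective d
  rw [← map_mul, ← map_one (Ideal.Quotient.mk I), Ideal.Quotient.mk_eq_mk_iff_sub_mem] at hcd hdc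
  obtain ⟨g', hg', hg⟩ := h f hf g hcd hdc
  exact ⟨g', hg', (Ideal.Quotient.mk_eq_mk_iff_sub_mem _ _).mpr hg⟩

end TwistedCrossed

open TwistedCrossed in
theorem mainTheorem3 {G : Type u} [Group G] (hG : IsRigidlySymmetric.{u, max u v} G)
    {A : Type v} [CStarAlgebra A] (S : TwistedSystem G A) (J : S.InvariantIdeal) :
    IsInverseClosedMod S.l1Subalgebra.toSubalgebra J.crossedIdeal ∧
      IsInverseClosed
        (S.l1Subalgebra.toSubalgebra.map (Ideal.Quotient.mkₐ ℂ J.crossedIdeal)) := by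
  have h := TwistedSystem.isInverseClosedMod_l1Subalgebra J hG
  exact ⟨h, h.isInverseClosed_map⟩
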